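/- Let $\mathbf X=(X_t)_{t\in\mathbb Z}$ be a stationary Markov chain on the finite alphabet $\{1,\dots,m\}$ with (stochastic) transition matrix $$P^{\mathbf X}=\begin{pmatrix}P_{11}&V\\ W^t&P\end{pmatrix},$$ where $V,W$ are row vectors of length $m-1$ with $V\neq\mathbf 0$, $W\ne\mathbf 0$, and $P$ is the $(m-1)\times(m-1)$ block of transitions among the symbols $2,\dots,m$. Let $Y_t=\mathbf 1(X_t=1)$. A kernel on $\{0,1\}$ is a measurable family $\underline a\mapsto \kappa(\cdot\mid\underline a)$ of probability measures on $\{0,1\}$ indexed by the pasts $\underline a=\dots a_{-2}a_{-1}\in\{0,1\}^{-\mathbb N}$; it is compatible with $\mathbf Y$ if it is a regular version of the conditional law of $Y_0$ given $(Y_t)_{t<0}$; it is continuous if $\underline a\mapsto\kappa(x\mid\underline a)$ is continuous for the product topology for each $x$; its continuity rate is $$\beta(n)=\sup_{a_0,a_{-n}^{-1}}\ \sup_{\underline b,\underline c}\ \bigl|\kappa(a_0\mid \underline b\,a_{-n}^{-1})-\kappa(a_0\mid\underline c\,a_{-n}^{-1})\bigr| .$$ The process $\mathbf Y$ is called continuous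 if it is compatible with some continuous kernel. 1. If $P$ is primitive, then there is a continuous kernel $P^{\mathbf Y}$ compatible with $\mathbf Y$ and satisfying $P^{\mathbf Y}(1\mid\underline a)=\mathbb P(Y_0=1\mid Y_{-1}=\dots=Y_{-k}=0,\,Y_{-k-1}=1)$ for every $k\ge0$ and every past $\underline a$ with $a_{-1}=\dots=a_{-k}=0$, $a_{-k-1}=1$. The maximal eigenvalue $\lambda_1$ of $P$ is positive, and, as $n\to\infty$, $$\beta^{\mathbf Y}(n)=O\!\left(n^{d_2-1}\left(\frac{|\lambda_2|}{\lambda_1}\right)^n\right),$$ where $\lambda_2$ is an eigenvalue of largest absolute value among the eigenvalues of $P$ other than $\lambda_1$, chosen of largest algebraic multiplicity among those of this absolute value, and $d_2$ is its algebraic multiplicity ($\lambda_2=0$, $d_2=1$ if $\lambda_1$ is the only eigenvalue). 2. If $P$ is irreducible with period $h$, let $\lambda_1^*$ be the maximal eigenvalue of $P^h$. Then $\lambda_1^*>0$, and there is a matrix $G^*$, the Perron projector of $P^h$: it is idempotent, its column space is the space of right eigenvectors of $P^h$ for $\lambda_1^*$, and its row space is the space of left eigenvectors. The matrix $G^*$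 is nonnegative, with $G^*_{ij}>0$ exactly when $(P^{hk})_{ij}>0$ for some $k\ge0$; moreover $VG^*P^r\mathbf 1^t>0$ for all $r\ge0$. The process $\mathbf Y$ is continuous if and only if $$\frac{VG^*P^rW^t}{VG^*P^r\mathbf 1^t}=\frac{VG^*W^t}{VG^*\mathbf 1^t}\qquad\text{for all } r=1,\dots,h-1 .$$ -/

import Mathlib

open MeasureTheory ProbabilityTheory Filter Topology Matrix

namespace RenewalFactor

noncomputable section

/-! ### Chains, kernels, continuity -/

/-- Infinite pasts `… a₋₂ a₋₁`; the coordinate `i : ℕ` holds the symbol at time `-(i+1)`. -/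
abbrev Past (S : Type*) := ℕ → S

/-- The past `z a₋ₖ … a₋₁`: the `k` most recent symbols are `a` (most recent first), preceded
by the past `z`. -/
def Past.append {S : Type*} {k : ℕ} (a : Fin k → S) (z : Past S) : Past S :=
  fun i => if h : i < k then a ⟨i, h⟩ else z (i - k)

/-- The past of a process before time `0`. -/
def pastOf {Ω S : Type*} (Y : ℤ → Ω → S) (ω : Ω) : Past S := fun i => Y (-((i : ℤ) + 1)) ω

/-- `X` is a stationary Markov chain with transition matrix `Q`. -/
structure IsStationaryMarkovChain {Ω S : Type*} [MeasurableSpace Ω] [MeasurableSpace S]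
    (μ : Measure Ω) (Q : Matrix S S ℝ) (X : ℤ → Ω → S) : Prop where
  measurable : ∀ t, Measurable (X t)
  stationary : ∀ (n : ℕ) (k : ℤ) (a : Fin n → S),
    μ {ω | ∀ i : Fin n, X (k + (i : ℕ)) ω = a i} = μ {ω | ∀ i : Fin n, X ((i : ℕ) : ℤ) ω = a i}
  markov : ∀ (t : ℤ) (n : ℕ) (a : ℕ → S) (b : S),
    μ.real {ω | X (t + 1) ω = b ∧ ∀ i ≤ n, X (t - (i : ℕ)) ω = a i} =
      μ.real {ω | ∀ i ≤ n, X (t - (i : ℕ)) ω = a i} * Q (a 0) b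

/-- The (stationary) process `Y` is compatible with the kernel `κ`: `κ` is a regular version of
the conditional law of `Y₀` given the whole past `… Y₋₂ Y₋₁`. -/
def Compatible {Ω S : Type*} [MeasurableSpace Ω] [MeasurableSpace S]
    (μ : Measure Ω) (Y : ℤ → Ω → S) (κ : Kernel (Past S) S) : Prop :=
  ∀ x : S, μ[(Y 0 ⁻¹' {x}).indicator (fun _ => (1 : ℝ)) |
      MeasurableSpace.comap (pastOf Y) inferInstance] =ᵐ[μ]
    fun ω => (κ (pastOf Y ω)).real {x}

/-- A kernel is continuous if it is continuous at every past, for the product topology. -/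
def ContinuousKernel {S : Type*} [MeasurableSpace S] [TopologicalSpace S]
    (κ : Kernel (Past S) S) : Prop :=
  ∀ (a : Past S) (x : S), ContinuousAt (fun b : Past S => (κ b).real {x}) a

/-- The continuity rate `β(k)` of a kernel. -/
def continuityRate {S : Type*} [MeasurableSpace S] (κ : Kernel (Past S) S) (k : ℕ) : ℝ :=
  ⨆ q : S × (Fin k → S) × Past S × Past S,
    |(κ (Past.append q.2.1 q.2.2.1)).real {q.1} - (κ (Past.append q.2.1 q.2.2.2)).real {q.1}|

/-- The process `Y` is continuous: it is compatible with some continuous kernel. -/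
def ContinuousProcess {Ω S : Type*} [MeasurableSpace Ω] [MeasurableSpace S] [TopologicalSpace S]
    (μ : Measure Ω) (Y : ℤ → Ω → S) : Prop :=
  ∃ κ : Kernel (Past S) S, IsMarkovKernel κ ∧ Compatible μ Y κ ∧ ContinuousKernel κ

/-! ### The aggregation map -/

/-- The aggregation map on `{0, …, N}`; the distinguished symbol is `0`. -/
def aggregation {N : ℕ} (a : Fin (N + 1)) : Fin 2 := if a = 0 then 1 else 0

/-- The image process of `X` under the aggregation map. -/
def image {Ω : Type*} {N : ℕ} (X : ℤ → Ω → Fin (N + 1)) : ℤ → Ω → Fin 2 :=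
  fun t ω => aggregation (X t ω)

/-- `ℓ(a) = k`: the most recent `1` of the binary past `a` is at time `-(k+1)`. -/
def LastOneAt (a : Past (Fin 2)) (k : ℕ) : Prop := a k = 1 ∧ ∀ i < k, a i = 0

/-- `pₖ = ℙ(Y₀ = 1 | Y₋₁ = ⋯ = Y₋ₖ = 0, Y₋₍ₖ₊₁₎ = 1)`. -/
def renewalProb {Ω : Type*} [MeasurableSpace Ω] (μ : Measure Ω) (Y : ℤ → Ω → Fin 2) (k : ℕ) : ℝ :=
  μ.real {ω | Y 0 ω = 1 ∧ LastOneAt (pastOf Y ω) k} / μ.real {ω | LastOneAt (pastOf Y ω) k}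

/-! ### The block decomposition of the transition matrix -/

/-- The row `V` of transitions from the distinguished symbol to the others. -/
def rowV {N : ℕ} (Q : Matrix (Fin (N + 1)) (Fin (N + 1)) ℝ) : Fin N → ℝ := fun j => Q 0 j.succ

/-- The vector `W` of transitions from the other symbols to the distinguished one. -/
def colW {N : ℕ} (Q : Matrix (Fin (N + 1)) (Fin (N + 1)) ℝ) : Fin N → ℝ := fun i => Q i.succ 0

/-- The substochastic block `P`. -/
def blockP {N : ℕ} (Q : Matrix (Fin (N + 1)) (Fin (N + 1)) ℝ) : Matrix (Fin N) (Fin N) ℝ :=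
  Q.submatrix Fin.succ Fin.succ

/-! ### Period, eigenvalues, Perron projector -/

/-- Every state of `M` has period `h`: `h = gcd {n ≥ 1 : (Mⁿ)ᵢᵢ > 0}` for every `i`. -/
def HasPeriod {N : ℕ} (M : Matrix (Fin N) (Fin N) ℝ) (h : ℕ) : Prop :=
  ∀ i, (∀ n > 0, 0 < (M ^ n) i i → h ∣ n) ∧
    ∀ d : ℕ, (∀ n > 0, 0 < (M ^ n) i i → d ∣ n) → d ∣ h

/-- The complex eigenvalues of a real matrix, with algebraic multiplicity. -/
def eigs {N : ℕ} (M : Matrix (Fin N) (Fin N) ℝ) : Multiset ℂ :=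
  (M.map (algebraMap ℝ ℂ)).charpoly.roots

/-- `r` is the maximal eigenvalue (Perron value) of `M`. -/
def IsPerronValue {N : ℕ} (M : Matrix (Fin N) (Fin N) ℝ) (r : ℝ) : Prop :=
  (r : ℂ) ∈ eigs M ∧ ∀ z ∈ eigs M, ‖z‖ ≤ r

/-- `z` is a second largest eigenvalue in absolute value, after the maximal eigenvalue `r`, and
`d` is its multiplicity; among the eigenvalues other than `r` of the second largest absolute
value, `z` is one of the largest multiplicity. If `r` is the only eigenvalue, then `z = 0` and
`d = 1` by convention. -/
def IsSecondEigenvalue {N : ℕ} (M : Matrix (Fin N) (Fin N) ℝ) (r : ℝ) (z : ℂ) (d : ℕ) : Prop :=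
  (z ∈ eigs M ∧ z ≠ r ∧ d = (eigs M).count z ∧
    ∀ w ∈ eigs M, w ≠ r → ‖w‖ ≤ ‖z‖ ∧ (‖w‖ = ‖z‖ → (eigs M).count w ≤ d)) ∨
  ((∀ w ∈ eigs M, w = r) ∧ z = 0 ∧ d = 1)

/-- `G` is the spectral projector of `M` at `r`: it is idempotent, its column space is the space
of right eigenvectors of `M` at `r`, and its row space is the space of left eigenvectors. (These
properties determine `G`; if both spaces are lines, spanned by `φ` and `ψ` with `ψ ⬝ φ = 1`, then
`G = φ ψᵗ`.) -/
structure IsPerronProjector {N : ℕ} (M : Matrix (Fin N) (Fin N) ℝ) (r : ℝ)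
    (G : Matrix (Fin N) (Fin N) ℝ) : Prop where
  idem : G * G = G
  right : ∀ v : Fin N → ℝ, G *ᵥ v = v ↔ M *ᵥ v = r • v
  left : ∀ v : Fin N → ℝ, v ᵥ* G = v ↔ v ᵥ* M = r • v

end

end RenewalFactor

open RenewalFactor

/-! The distinguished symbol is a single state of the chain, so a visit to it erases everything
earlier. Given that the last `1` of the binary past lies `k` zeros back, the next symbol is
therefore independent of the older past (`renewal`), and `Y` is a renewal process governed by the
numbers `p k` (`renewalProb`). An excursion leaves the distinguished state through `V`, wanders by
`P`, and returns through `W`, hence `p (k + 1)` is the quotient of `V P ^ k W` by `V P ^ k 1`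
(`renewalProb_succ`). Pairing the stationary law with a positive eigenvector of `P` shows that the
Perron value is less than 1, so almost surely some `1` occurs in the past.

A kernel that depends only on the position of the last `1` is locally constant at every past
containing a `1`; the all-zero past is the only critical point. Continuity of the process thus
amounts to convergence of `p`. Sufficiency is direct (`exists_continuousKernel`). Necessity
evaluates an arbitrary continuous compatible kernel along pasts that tend to the all-zero one.

Convergence of `p` is a matter of matrix powers. For irreducible `P` of period `h` and Perron value
`λ`, the powers of `P ^ h`, normalised by `λ ^ h`, converge to the Perron projector `G`
(`perron_frobenius`). Along each residue class `r` modulo `h`, `p` then converges to the quotient of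
`V G P ^ r W` by `V G P ^ r 1`, and `p` converges exactly when these limits coincide.

In the primitive case `h = 1`. The error `P ^ n - λ ^ n G` vanishes on the generalised eigenspace of
`λ`, which has no nontrivial Jordan block because the normalised powers converge; on the other
generalised eigenspaces the binomial expansion gives the growth `n ^ (d - 1) * |w| ^ n`
(`isBigO_pow_sub`). This passes to the quotients and then to the supremum defining the continuity
rate. -/

namespace RenewalFactor

/-! ### Growth of matrix powers on generalised eigenspaces -/

section PowerLimit

open Asymptotics Polynomial

variable {ι : Type*} [Fintype ι] [DecidableEq ι]

/-- Controls one term of the binomial expansion of `(C + w) ^ n`, using `n.choose m ≤ n ^ m`. For `w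
= 0` the term vanishes as soon as `n > m`. -/
theorem isBigO_choose_mul_pow (w : ℂ) {m D : ℕ} (hm : m ≤ D) (c : ℂ) :
    (fun n : ℕ => (w ^ (n - m) * (n.choose m : ℂ)) * c) =O[atTop]
      (fun n : ℕ => (n : ℝ) ^ D * ‖w‖ ^ n) := by
  rcases eq_or_ne w 0 with rfl | hw
  · refine (isBigO_zero _ _).congr' ?_ EventuallyEq.rfl
    filter_upwards [eventually_gt_atTop m] with n hn
    simp [zero_pow (Nat.sub_ne_zero_of_lt hn)]
  · refine IsBigO.of_bound (‖c‖ / ‖w‖ ^ m) ?_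
    filter_upwards [eventually_ge_atTop (m + 1)] with n hn
    have hw' : 0 < ‖w‖ := norm_pos_iff.2 hw
    have h1 : ‖w‖ ^ (n - m) = ‖w‖ ^ n / ‖w‖ ^ m := by
      rw [eq_div_iff (by positivity), ← pow_add, Nat.sub_add_cancel (by omega)]
    have h2 : (n.choose m : ℝ) ≤ (n : ℝ) ^ D := by
      calc (n.choose m : ℝ) ≤ (n : ℝ) ^ m := by exact_mod_cast Nat.choose_le_pow n m
        _ ≤ (n : ℝ) ^ D := pow_le_pow_right₀ (by exact_mod_cast (by omega : 1 ≤ n)) hm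
    simp only [norm_mul, norm_pow, Complex.norm_natCast, Real.norm_natCast, norm_norm]
    rw [h1]
    calc ‖w‖ ^ n / ‖w‖ ^ m * (n.choose m) * ‖c‖ ≤ ‖w‖ ^ n / ‖w‖ ^ m * (n : ℝ) ^ D * ‖c‖ := by
          gcongr
      _ = _ := by ring

/-- Growth of the orbit of a generalised eigenvector. -/
theorem isBigO_pow_mulVec_of_genEigenvector (B : Matrix ι ι ℂ) (w : ℂ) (d : ℕ) (x : ι → ℂ)
    (hx : ((B - w • (1 : Matrix ι ι ℂ)) ^ d) *ᵥ x = 0) (i : ι) :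
    (fun n : ℕ => (B ^ n *ᵥ x) i) =O[atTop] (fun n : ℕ => (n : ℝ) ^ (d - 1) * ‖w‖ ^ n) := by
  set C := B - w • (1 : Matrix ι ι ℂ) with hC
  have hB : B = C + w • (1 : Matrix ι ι ℂ) := by simp [hC]
  have hcomm : Commute C (w • (1 : Matrix ι ι ℂ)) := by
    simp [Commute, SemiconjBy]
  have hvan : ∀ m ≥ d, C ^ m *ᵥ x = 0 := by
    intro m hm
    rw [← Nat.sub_add_cancel hm, pow_add, ← mulVec_mulVec, hx, mulVec_zero]
  have hterm (n m : ℕ) :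
      C ^ m * (w • (1 : Matrix ι ι ℂ)) ^ (n - m) * ((n.choose m : ℕ) : Matrix ι ι ℂ) =
        (w ^ (n - m) * (n.choose m : ℂ)) • C ^ m := by
    rw [_root_.smul_pow, one_pow, ← nsmul_eq_mul']
    simp only [mul_smul_comm, mul_one, smul_smul, ← Nat.cast_smul_eq_nsmul ℂ]
    ring_nf
  -- Since `C ^ d` kills `x`, only the terms with `m < d` survive; this is the source of the
  -- exponent `d - 1`.
  have key : ∀ n ≥ d, (B ^ n *ᵥ x) i =
      ∑ m ∈ Finset.range d, (w ^ (n - m) * (n.choose m : ℂ)) * (C ^ m *ᵥ x) i := by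
    intro n hn
    rw [hB, hcomm.add_pow, Matrix.sum_mulVec, Finset.sum_apply,
      ← Finset.sum_subset (Finset.range_mono (by omega : d ≤ n + 1))]
    · refine Finset.sum_congr rfl fun m _ => ?_
      rw [hterm, smul_mulVec, Pi.smul_apply, smul_eq_mul]
    · intro m _ hm
      have hm : d ≤ m := by simpa using hm
      rw [hterm, smul_mulVec, hvan m hm]
      simp
  refine IsBigO.congr' (f₁ := fun n : ℕ =>
    ∑ m ∈ Finset.range d, (w ^ (n - m) * (n.choose m : ℂ)) * (C ^ m *ᵥ x) i) ?_ ?_ EventuallyEq.rfl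
  · refine IsBigO.fun_sum fun m hm => isBigO_choose_mul_pow w ?_ _
    have := Finset.mem_range.1 hm
    omega
  · filter_upwards [eventually_ge_atTop d] with n hn using (key n hn).symm

/-- Distinct linear factors are coprime, so the kernel of the product splits. Applied to the
characteristic polynomial, whose kernel is everything by Cayley–Hamilton, this decomposes the space
into generalised eigenspaces. -/
theorem ker_aeval_prod_X_sub_C_pow {M : Type*} [AddCommGroup M] [Module ℂ M] (f : M →ₗ[ℂ] M)
    (s : Finset ℂ) (d : ℂ → ℕ) :
    LinearMap.ker (aeval f (∏ w ∈ s, (X - C w) ^ d w)) ≤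
      ⨆ w ∈ s, LinearMap.ker (aeval f ((X - C w) ^ d w)) := by
  induction s using Finset.induction_on with
  | empty => simp [Module.End.one_eq_id]
  | insert a s ha ih =>
    rw [Finset.prod_insert ha, ← sup_ker_aeval_eq_ker_aeval_mul_of_coprime, Finset.iSup_insert]
    · exact sup_le_sup le_rfl ih
    · refine IsCoprime.prod_right fun w hw => IsCoprime.pow ?_
      refine isCoprime_X_sub_C_of_isUnit_sub ?_
      exact (sub_ne_zero.2 (by rintro rfl; exact ha hw)).isUnit

/-- A linear property of vectors holds everywhere if it holds on the generalised eigenspaces. -/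
theorem induction_genEigenvector (B : Matrix ι ι ℂ) (p : (ι → ℂ) → Prop) (h0 : p 0)
    (hadd : ∀ x y, p x → p y → p (x + y))
    (hgen : ∀ w ∈ B.charpoly.roots, ∀ x,
      ((B - w • (1 : Matrix ι ι ℂ)) ^ B.charpoly.roots.count w) *ᵥ x = 0 → p x) (x : ι → ℂ) :
    p x := by
  have hprod : B.charpoly = ∏ w ∈ B.charpoly.roots.toFinset,
      (X - C w) ^ B.charpoly.roots.count w := by
    rw [← Finset.prod_multiset_map_count]
    exact (IsAlgClosed.splits B.charpoly).eq_prod_roots_of_monic B.charpoly_monic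
  have hker := ker_aeval_prod_X_sub_C_pow (Matrix.toLin' B) B.charpoly.roots.toFinset
    (fun w => B.charpoly.roots.count w)
  rw [← hprod] at hker
  have hx : x ∈ LinearMap.ker (aeval (Matrix.toLin' B) B.charpoly) := by
    have : aeval (Matrix.toLin' B) B.charpoly = 0 := by
      rw [← Matrix.charpoly_toLin', LinearMap.aeval_self_charpoly]
    rw [this]; simp
  refine Submodule.iSup_induction (fun w => ⨆ (_ : w ∈ B.charpoly.roots.toFinset),
    LinearMap.ker (aeval (Matrix.toLin' B) ((X - C w) ^ B.charpoly.roots.count w)))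
    (motive := p) (hker hx) (fun w y hy => ?_) h0 hadd
  by_cases hw : w ∈ B.charpoly.roots.toFinset
  · simp only [hw, iSup_pos] at hy
    refine hgen w (Multiset.mem_toFinset.1 hw) y ?_
    rw [LinearMap.mem_ker] at hy
    rw [← hy, map_pow, map_sub, aeval_X, aeval_C, ← Matrix.toLin'_apply, Matrix.toLin'_pow, map_sub]
    simp [Algebra.algebraMap_eq_smul_one, Module.End.one_eq_id]
  · simp only [hw, iSup_false] at hy
    rw [Submodule.mem_bot] at hy
    rwa [hy]

end PowerLimit

/-! ### Spectral consequences of the convergence of normalised powers -/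

section Limit

open Asymptotics

/-- On the unit circle the limit has norm 1 and satisfies `L = u * L`, which forces `u = 1`. This
excludes other eigenvalues of maximal modulus. -/
theorem norm_lt_one_or_eq_one_of_tendsto_pow {u L : ℂ}
    (h : Tendsto (fun n : ℕ => u ^ n) atTop (𝓝 L)) : ‖u‖ < 1 ∨ u = 1 := by
  rcases lt_trichotomy ‖u‖ 1 with hu | hu | hu
  · exact Or.inl hu
  · right
    have h1 : L = u * L := tendsto_nhds_unique (h.comp (tendsto_add_atTop_nat 1))
      ((h.const_mul u).congr fun n => by simp [pow_succ'])
    have h2 : ‖L‖ = 1 := tendsto_nhds_unique h.norm (by simp [hu])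
    have h3 : L ≠ 0 := by rw [← norm_pos_iff, h2]; exact one_pos
    exact (mul_right_cancel₀ h3 (by rw [one_mul, ← h1])).symm
  · exfalso
    have h1 := h.norm
    simp only [norm_pow] at h1
    exact not_tendsto_nhds_of_tendsto_atTop (tendsto_pow_atTop_atTop_of_one_lt hu) _ h1

theorem isBigO_pow_mul_pow_of_lt {r s : ℝ} (hr : 0 ≤ r) (hrs : r < s) (a b : ℕ) :
    (fun n : ℕ => (n : ℝ) ^ a * r ^ n) =O[atTop] (fun n : ℕ => (n : ℝ) ^ b * s ^ n) := by
  have h1 : (fun n : ℕ => (n : ℝ) ^ a * r ^ n) =O[atTop] (fun n : ℕ => s ^ n) :=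
    (isLittleO_pow_const_mul_const_pow_const_pow_of_norm_lt (R := ℝ) a
      (by rwa [Real.norm_of_nonneg hr])).isBigO
  refine h1.trans (IsBigO.of_bound 1 ?_)
  filter_upwards [eventually_ge_atTop 1] with n hn
  have h2 : (1 : ℝ) ≤ (n : ℝ) ^ b := one_le_pow₀ (by exact_mod_cast hn)
  rw [norm_mul, one_mul, Real.norm_of_nonneg (by positivity : (0 : ℝ) ≤ (n : ℝ) ^ b)]
  exact le_mul_of_one_le_left (norm_nonneg _) h2

theorem isBigO_pow_mul_pow_of_le {a b : ℕ} (hab : a ≤ b) (r : ℝ) :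
    (fun n : ℕ => (n : ℝ) ^ a * r ^ n) =O[atTop] (fun n : ℕ => (n : ℝ) ^ b * r ^ n) := by
  refine IsBigO.of_bound 1 ?_
  filter_upwards [eventually_ge_atTop 1] with n hn
  rw [norm_mul, norm_mul, one_mul]
  gcongr
  rw [Real.norm_of_nonneg (by positivity), Real.norm_of_nonneg (by positivity)]
  exact pow_le_pow_right₀ (by exact_mod_cast hn) hab

variable {𝕜 : Type*} [RCLike 𝕜] {ι : Type*} [Fintype ι] [DecidableEq ι]

section General

variable {A G : Matrix ι ι 𝕜} {lam : 𝕜}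

/-- One more factor `A` only shifts the index of the sequence, at the cost of a factor `lam`. -/
theorem mul_eq_smul_of_tendsto (hlam : lam ≠ 0)
    (hlim : Tendsto (fun n : ℕ => (lam ^ n)⁻¹ • A ^ n) atTop (𝓝 G)) : A * G = lam • G := by
  have h1 : Tendsto (fun n : ℕ => A * ((lam ^ n)⁻¹ • A ^ n)) atTop (𝓝 (A * G)) :=
    ((continuous_const.matrix_mul continuous_id).tendsto G).comp hlim
  refine tendsto_nhds_unique h1
    (((hlim.comp (tendsto_add_atTop_nat 1)).const_smul lam).congr fun n => ?_)
  simp only [Function.comp_apply, Algebra.mul_smul_comm, smul_smul, pow_succ']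
  congr 1
  field_simp

theorem mul_eq_smul_of_tendsto' (hlam : lam ≠ 0)
    (hlim : Tendsto (fun n : ℕ => (lam ^ n)⁻¹ • A ^ n) atTop (𝓝 G)) : G * A = lam • G := by
  have h1 : Tendsto (fun n : ℕ => ((lam ^ n)⁻¹ • A ^ n) * A) atTop (𝓝 (G * A)) :=
    ((continuous_id.matrix_mul continuous_const).tendsto G).comp hlim
  refine tendsto_nhds_unique h1
    (((hlim.comp (tendsto_add_atTop_nat 1)).const_smul lam).congr fun n => ?_)
  simp only [Function.comp_apply, Algebra.smul_mul_assoc, smul_smul, pow_succ, mul_inv]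
  congr 1
  field_simp

theorem pow_mulVec_of_eigenvector {z : 𝕜} {v : ι → 𝕜} (hv : A *ᵥ v = z • v) (n : ℕ) :
    A ^ n *ᵥ v = z ^ n • v := by
  induction n with
  | zero => simp
  | succ n ih => rw [pow_succ', ← mulVec_mulVec, ih, mulVec_smul, hv, smul_smul, pow_succ]

theorem pow_vecMul_of_eigenvector {z : 𝕜} {v : ι → 𝕜} (hv : v ᵥ* A = z • v) (n : ℕ) :
    v ᵥ* A ^ n = z ^ n • v := by
  induction n with
  | zero => simp
  | succ n ih => rw [pow_succ, ← vecMul_vecMul, ih, smul_vecMul, hv, smul_smul, pow_succ]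

theorem mulVec_eq_self_of_eigenvector (hlam : lam ≠ 0)
    (hlim : Tendsto (fun n : ℕ => (lam ^ n)⁻¹ • A ^ n) atTop (𝓝 G)) {v : ι → 𝕜}
    (hv : A *ᵥ v = lam • v) : G *ᵥ v = v := by
  have h1 : Tendsto (fun n : ℕ => ((lam ^ n)⁻¹ • A ^ n) *ᵥ v) atTop (𝓝 (G *ᵥ v)) :=
    ((continuous_id.matrix_mulVec continuous_const).tendsto G).comp hlim
  refine tendsto_nhds_unique h1 (tendsto_const_nhds.congr fun n => ?_)
  rw [smul_mulVec, pow_mulVec_of_eigenvector hv, smul_smul, inv_mul_cancel₀ (pow_ne_zero n hlam),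
    one_smul]

theorem vecMul_eq_self_of_eigenvector (hlam : lam ≠ 0)
    (hlim : Tendsto (fun n : ℕ => (lam ^ n)⁻¹ • A ^ n) atTop (𝓝 G)) {v : ι → 𝕜}
    (hv : v ᵥ* A = lam • v) : v ᵥ* G = v := by
  have h1 : Tendsto (fun n : ℕ => v ᵥ* ((lam ^ n)⁻¹ • A ^ n)) atTop (𝓝 (v ᵥ* G)) :=
    ((continuous_const.matrix_vecMul continuous_id).tendsto G).comp hlim
  refine tendsto_nhds_unique h1 (tendsto_const_nhds.congr fun n => ?_)
  rw [vecMul_smul, pow_vecMul_of_eigenvector hv, smul_smul, inv_mul_cancel₀ (pow_ne_zero n hlam),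
    one_smul]

theorem pow_mul_of_mul_eq_smul (h : A * G = lam • G) (n : ℕ) : A ^ n * G = lam ^ n • G := by
  induction n with
  | zero => simp
  | succ n ih => rw [pow_succ', mul_assoc, ih, mul_smul_comm, h, smul_smul, pow_succ]

theorem idempotent_of_tendsto (hlam : lam ≠ 0)
    (hlim : Tendsto (fun n : ℕ => (lam ^ n)⁻¹ • A ^ n) atTop (𝓝 G)) : G * G = G := by
  have h1 : Tendsto (fun n : ℕ => ((lam ^ n)⁻¹ • A ^ n) * G) atTop (𝓝 (G * G)) :=
    ((continuous_id.matrix_mul continuous_const).tendsto G).comp hlim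
  refine tendsto_nhds_unique h1 (tendsto_const_nhds.congr fun n => ?_)
  rw [smul_mul_assoc, pow_mul_of_mul_eq_smul (mul_eq_smul_of_tendsto hlam hlim), smul_smul,
    inv_mul_cancel₀ (pow_ne_zero n hlam), one_smul]

/-- The eigenvalue `lam` is semisimple. By induction on `e`, the vector `(A - lam) y` is again
killed by `G` and by a lower power, hence is zero; so `y` is an eigenvector, is fixed by `G`, and
vanishes. -/
theorem eq_zero_of_genEigenvector (hlam : lam ≠ 0)
    (hlim : Tendsto (fun n : ℕ => (lam ^ n)⁻¹ • A ^ n) atTop (𝓝 G)) (e : ℕ) (y : ι → 𝕜)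
    (hG : G *ᵥ y = 0) (hy : ((A - lam • (1 : Matrix ι ι 𝕜)) ^ e) *ᵥ y = 0) : y = 0 := by
  induction e generalizing y with
  | zero => simpa using hy
  | succ e ih =>
    have h1 : (A - lam • (1 : Matrix ι ι 𝕜)) *ᵥ y = 0 := by
      refine ih _ ?_ (by rw [mulVec_mulVec, ← pow_succ, hy])
      rw [mulVec_mulVec, mul_sub, mul_eq_smul_of_tendsto' hlam hlim, mul_smul_comm, mul_one,
        sub_self, zero_mulVec]
    rw [sub_mulVec, smul_mulVec, one_mulVec, sub_eq_zero] at h1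
    rw [← mulVec_eq_self_of_eigenvector hlam hlim h1, hG]

end General

variable {N : ℕ} {A G : Matrix (Fin N) (Fin N) ℝ} {lam : ℝ}

theorem isPerronProjector_of_tendsto (hlam : 0 < lam)
    (hlim : Tendsto (fun n : ℕ => (lam ^ n)⁻¹ • A ^ n) atTop (𝓝 G)) :
    IsPerronProjector A lam G where
  idem := idempotent_of_tendsto hlam.ne' hlim
  right v := by
    refine ⟨fun h => ?_, mulVec_eq_self_of_eigenvector hlam.ne' hlim⟩
    rw [← h, mulVec_mulVec, mul_eq_smul_of_tendsto hlam.ne' hlim, smul_mulVec]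
  left v := by
    refine ⟨fun h => ?_, vecMul_eq_self_of_eigenvector hlam.ne' hlim⟩
    rw [← h, vecMul_vecMul, mul_eq_smul_of_tendsto' hlam.ne' hlim, vecMul_smul]

theorem tendsto_map_complex (hlim : Tendsto (fun n : ℕ => (lam ^ n)⁻¹ • A ^ n) atTop (𝓝 G)) :
    Tendsto (fun n : ℕ => ((lam : ℂ) ^ n)⁻¹ • A.map (algebraMap ℝ ℂ) ^ n) atTop
      (𝓝 (G.map (algebraMap ℝ ℂ))) := by
  refine (((continuous_id.matrix_map Complex.continuous_ofReal).tendsto G).comp hlim).congr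
    fun n => ?_
  have h : A.map (algebraMap ℝ ℂ) ^ n = (A ^ n).map (algebraMap ℝ ℂ) :=
    (map_pow (algebraMap ℝ ℂ).mapMatrix A n).symm
  rw [h]
  ext i j
  simp

/-- On an eigenvector the normalised powers act as `(z / lam) ^ n`, which must converge. -/
theorem eigs_of_tendsto (hlam : 0 < lam)
    (hlim : Tendsto (fun n : ℕ => (lam ^ n)⁻¹ • A ^ n) atTop (𝓝 G)) {z : ℂ} (hz : z ∈ eigs A) :
    ‖z‖ < lam ∨ z = lam := by
  have hl : (lam : ℂ) ≠ 0 := by exact_mod_cast hlam.ne'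
  have h1 : Module.End.HasEigenvalue (Matrix.toLin' (A.map (algebraMap ℝ ℂ))) z := by
    rw [Module.End.hasEigenvalue_iff_isRoot_charpoly, Matrix.charpoly_toLin']
    exact Polynomial.isRoot_of_mem_roots hz
  obtain ⟨x, hx, hx0⟩ := h1.exists_hasEigenvector
  rw [Module.End.mem_eigenspace_iff, Matrix.toLin'_apply] at hx
  obtain ⟨i, hi⟩ := Function.ne_iff.1 hx0
  simp only [Pi.zero_apply] at hi
  have h2 : Tendsto (fun n : ℕ => (((lam : ℂ) ^ n)⁻¹ • A.map (algebraMap ℝ ℂ) ^ n) *ᵥ x) atTop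
      (𝓝 (G.map (algebraMap ℝ ℂ) *ᵥ x)) :=
    ((continuous_id.matrix_mulVec continuous_const).tendsto _).comp (tendsto_map_complex hlim)
  have h3 := (tendsto_pi_nhds.1 h2 i).div_const (x i)
  have h4 : Tendsto (fun n : ℕ => (z / lam) ^ n) atTop
      (𝓝 ((G.map (algebraMap ℝ ℂ) *ᵥ x) i / x i)) := by
    refine h3.congr fun n => ?_
    rw [smul_mulVec, pow_mulVec_of_eigenvector hx, smul_smul, Pi.smul_apply, smul_eq_mul,
      mul_div_assoc, div_self hi, mul_one, div_pow]
    field_simp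
  rcases norm_lt_one_or_eq_one_of_tendsto_pow h4 with h | h
  · left
    rwa [norm_div, Complex.norm_real, Real.norm_of_nonneg hlam.le, div_lt_one hlam] at h
  · right
    exact (div_eq_one_iff_eq hl).1 h

theorem isPerronValue_of_tendsto (hlam : 0 < lam)
    (hlim : Tendsto (fun n : ℕ => (lam ^ n)⁻¹ • A ^ n) atTop (𝓝 G)) {v : Fin N → ℝ} (hv0 : v ≠ 0)
    (hv : A *ᵥ v = lam • v) : IsPerronValue A lam := by
  refine ⟨?_, fun z hz => ?_⟩
  · have h1 : Module.End.HasEigenvalue (Matrix.toLin' A) lam :=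
      Module.End.hasEigenvalue_of_hasEigenvector
        (Module.End.hasEigenvector_iff.2
          ⟨Module.End.mem_eigenspace_iff.2 (by rw [Matrix.toLin'_apply, hv]), hv0⟩)
    rw [Module.End.hasEigenvalue_iff_isRoot_charpoly, Matrix.charpoly_toLin'] at h1
    rw [eigs, Polynomial.mem_roots (Matrix.charpoly_monic _).ne_zero, Matrix.charpoly_map]
    exact h1.map
  · rcases eigs_of_tendsto hlam hlim hz with h | h
    · exact h.le
    · rw [h, Complex.norm_real, Real.norm_of_nonneg hlam.le]

theorem norm_second_lt (hlam : 0 < lam)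
    (hlim : Tendsto (fun n : ℕ => (lam ^ n)⁻¹ • A ^ n) atTop (𝓝 G)) {z : ℂ} {d : ℕ}
    (hz : IsSecondEigenvalue A lam z d) : ‖z‖ < lam := by
  rcases hz with ⟨h1, h2, -⟩ | ⟨-, rfl, -⟩
  · exact (eigs_of_tendsto hlam hlim h1).resolve_right h2
  · simpa using hlam

/-- Speed of convergence of the normalised powers to the Perron projector. -/
theorem isBigO_pow_sub (hlam : 0 < lam)
    (hlim : Tendsto (fun n : ℕ => (lam ^ n)⁻¹ • A ^ n) atTop (𝓝 G)) {z : ℂ} {d : ℕ}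
    (hz : IsSecondEigenvalue A lam z d) (i j : Fin N) :
    (fun n : ℕ => (A ^ n) i j - lam ^ n * G i j) =O[atTop]
      (fun n : ℕ => (n : ℝ) ^ (d - 1) * ‖z‖ ^ n) := by
  set B := A.map (algebraMap ℝ ℂ) with hB
  set H := G.map (algebraMap ℝ ℂ) with hH
  have hl : (lam : ℂ) ≠ 0 := by exact_mod_cast hlam.ne'
  have hlimc : Tendsto (fun n : ℕ => ((lam : ℂ) ^ n)⁻¹ • B ^ n) atTop (𝓝 H) :=
    tendsto_map_complex hlim
  have hBH := mul_eq_smul_of_tendsto hl hlimc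
  have hHB := mul_eq_smul_of_tendsto' hl hlimc
  have hHH := idempotent_of_tendsto hl hlimc
  have hcomm : Commute B (1 - H) :=
    (Commute.one_right B).sub_right (show B * H = H * B by rw [hBH, hHB])
  -- Since `B ^ n * H = lam ^ n • H`, the error is `B ^ n * (1 - H)`. As `1 - H` commutes with `B`,
  -- it preserves each generalised eigenspace, so these can be treated one at a time.
  have main : ∀ x : Fin N → ℂ, ∀ i, (fun n : ℕ => (B ^ n *ᵥ ((1 - H) *ᵥ x)) i) =O[atTop]
      (fun n : ℕ => (n : ℝ) ^ (d - 1) * ‖z‖ ^ n) := by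
    intro x
    refine induction_genEigenvector B (fun x => ∀ i,
      (fun n : ℕ => (B ^ n *ᵥ ((1 - H) *ᵥ x)) i) =O[atTop]
        (fun n : ℕ => (n : ℝ) ^ (d - 1) * ‖z‖ ^ n)) ?_ ?_ ?_ x
    · intro i
      simp only [mulVec_zero, Pi.zero_apply]
      exact isBigO_zero _ _
    · intro x y hx hy i
      simp only [mulVec_add, Pi.add_apply]
      exact (hx i).add (hy i)
    · intro w hw x hx i
      have hc2 : ((B - w • (1 : Matrix (Fin N) (Fin N) ℂ)) ^ B.charpoly.roots.count w) *ᵥ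
          ((1 - H) *ᵥ x) = 0 := by
        have : Commute ((B - w • (1 : Matrix (Fin N) (Fin N) ℂ)) ^ B.charpoly.roots.count w)
            (1 - H) := by
          refine Commute.pow_left (hcomm.sub_left ?_) _
          simp [Commute, SemiconjBy]
        rw [mulVec_mulVec, this.eq, ← mulVec_mulVec, hx, mulVec_zero]
      by_cases hwl : w = lam
      · have h0 : (1 - H) *ᵥ x = 0 := by
          refine eq_zero_of_genEigenvector hl hlimc _ _ ?_ (by rw [← hwl]; exact hc2)
          rw [mulVec_mulVec, mul_sub, mul_one, hHH, sub_self, zero_mulVec]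
        simp only [h0, mulVec_zero, Pi.zero_apply]
        exact isBigO_zero _ _
      · refine (isBigO_pow_mulVec_of_genEigenvector B w _ _ hc2 i).trans ?_
        rcases hz with ⟨h1, h2, h3, h4⟩ | ⟨h1, -⟩
        · obtain ⟨h5, h6⟩ := h4 w hw hwl
          rcases h5.lt_or_eq with h7 | h7
          · exact isBigO_pow_mul_pow_of_lt (norm_nonneg _) h7 _ _
          -- For eigenvalues tied in modulus, the maximality of the multiplicity `d` gives the
          -- polynomial factor.
          · rw [h7]
            exact isBigO_pow_mul_pow_of_le (Nat.sub_le_sub_right (h6 h7) 1) _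
        · exact absurd (h1 w hw) hwl
  have := (main (Pi.single j 1) i).norm_left
  refine IsBigO.of_norm_left (this.congr_left fun n => ?_)
  have hp : B ^ n = (A ^ n).map (algebraMap ℝ ℂ) :=
    (map_pow (algebraMap ℝ ℂ).mapMatrix A n).symm
  rw [mulVec_mulVec, mul_sub, mul_one, pow_mul_of_mul_eq_smul hBH, mulVec_single_one, hp, hH]
  simp only [col_apply, Matrix.sub_apply, Matrix.smul_apply, map_apply, smul_eq_mul, Complex.coe_algebraMap]
  rw [← Complex.norm_real]
  push_cast
  rfl

end Limit

/-! ### Nonnegative matrices and Perron–Frobenius theory -/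

section Perron

variable {ι : Type*} [Fintype ι]

theorem mul_apply_pos {A B : Matrix ι ι ℝ} (hA : ∀ i j, 0 ≤ A i j) (hB : ∀ i j, 0 ≤ B i j)
    {i j k : ι} (h1 : 0 < A i j) (h2 : 0 < B j k) : 0 < (A * B) i k := by
  rw [mul_apply]
  exact Finset.sum_pos' (fun l _ => mul_nonneg (hA i l) (hB l k))
    ⟨j, Finset.mem_univ _, mul_pos h1 h2⟩

theorem mulVec_apply_pos {B : Matrix ι ι ℝ} (hB : ∀ i j, 0 < B i j) {z : ι → ℝ}
    (hz : ∀ i, 0 ≤ z i) (hz0 : z ≠ 0) (i : ι) : 0 < (B *ᵥ z) i := by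
  obtain ⟨j, hj⟩ := Function.ne_iff.1 hz0
  exact Finset.sum_pos' (fun k _ => mul_nonneg (hB i k).le (hz k))
    ⟨j, Finset.mem_univ _, mul_pos (hB i j) (lt_of_le_of_ne (hz j) (Ne.symm hj))⟩

theorem mulVec_apply_nonneg {B : Matrix ι ι ℝ} (hB : ∀ i j, 0 ≤ B i j) {z : ι → ℝ}
    (hz : ∀ i, 0 ≤ z i) (i : ι) : 0 ≤ (B *ᵥ z) i :=
  Finset.sum_nonneg fun k _ => mul_nonneg (hB i k) (hz k)

theorem exists_pos_forall_le [Nonempty ι] {f : ι → ℝ} (hf : ∀ i, 0 < f i) :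
    ∃ ε > 0, ∀ i, ε ≤ f i := by
  obtain ⟨i, hi⟩ := Finite.exists_min f
  exact ⟨f i, hf i, hi⟩

/-- A quantitative minimum principle: `a * φ` is fixed by `T` because `a` is constant along positive
entries, and the nonnegative excess `x - a * φ` contributes at least its term at `c`. -/
theorem le_mulVec_of_invariant {T : Matrix ι ι ℝ} (hT : ∀ i j, 0 ≤ T i j) {φ : ι → ℝ}
    (hφ : T *ᵥ φ = φ) {a x : ι → ℝ} (ha : ∀ i j, 0 < T i j → a i = a j)
    (hax : ∀ i, a i * φ i ≤ x i) (i c : ι) :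
    a i * φ i + T i c * (x c - a c * φ c) ≤ (T *ᵥ x) i := by
  have h1 : a i * φ i = ∑ j, T i j * (a j * φ j) := by
    conv_lhs => rw [← congrFun hφ i]
    rw [mulVec, dotProduct, Finset.mul_sum]
    refine Finset.sum_congr rfl fun j _ => ?_
    rcases (hT i j).lt_or_eq with h | h
    · rw [ha i j h]; ring
    · rw [← h]; ring
  have h2 : T i c * (x c - a c * φ c) ≤ ∑ j, T i j * (x j - a j * φ j) :=
    Finset.single_le_sum (f := fun j => T i j * (x j - a j * φ j))
      (fun j _ => mul_nonneg (hT i j) (sub_nonneg.2 (hax j))) (Finset.mem_univ c)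
  have h3 : (T *ᵥ x) i = ∑ j, T i j * (a j * φ j) + ∑ j, T i j * (x j - a j * φ j) := by
    rw [← Finset.sum_add_distrib]
    exact Finset.sum_congr rfl fun j _ => by ring
  rw [h1, h3]
  linarith

variable [DecidableEq ι]

theorem pow_nonneg_apply {A : Matrix ι ι ℝ} (hA : ∀ i j, 0 ≤ A i j) (n : ℕ) (i j : ι) :
    0 ≤ (A ^ n) i j := by
  induction n generalizing i j with
  | zero => rw [pow_zero, one_apply]; split_ifs <;> norm_num
  | succ n ih =>
    rw [pow_succ, mul_apply]
    exact Finset.sum_nonneg fun k _ => mul_nonneg (ih i k) (hA k j)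

theorem pow_add_apply_pos {A : Matrix ι ι ℝ} (hA : ∀ i j, 0 ≤ A i j) {m n : ℕ} {i j k : ι}
    (h1 : 0 < (A ^ m) i j) (h2 : 0 < (A ^ n) j k) : 0 < (A ^ (m + n)) i k := by
  rw [pow_add]
  exact mul_apply_pos (pow_nonneg_apply hA m) (pow_nonneg_apply hA n) h1 h2

/-- By homogeneity the vectors may be taken in the simplex, where admissible `s` are bounded by the
sum of the entries of `P`; the maximum then exists by compactness. -/
theorem exists_collatzWielandt_max [Nonempty ι] {P : Matrix ι ι ℝ} (hP : ∀ i j, 0 ≤ P i j) :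
    ∃ (t : ℝ) (x : ι → ℝ), 0 ≤ t ∧ (∀ i, 0 ≤ x i) ∧ x ≠ 0 ∧ (∀ i, t * x i ≤ (P *ᵥ x) i) ∧
      ∀ (s : ℝ) (y : ι → ℝ), 0 ≤ s → (∀ i, 0 ≤ y i) → y ≠ 0 →
        (∀ i, s * y i ≤ (P *ᵥ y) i) → s ≤ t := by
  set c : ℝ := ∑ i, ∑ j, P i j with hc
  set K : Set (ℝ × (ι → ℝ)) := (Set.Icc 0 c ×ˢ stdSimplex ℝ ι) ∩
    {p | ∀ i, p.1 * p.2 i ≤ (P *ᵥ p.2) i} with hK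
  have hKc : IsCompact K := by
    refine (isCompact_Icc.prod (isCompact_stdSimplex ℝ ι)).inter_right ?_
    simp only [Set.ofPred_forall]
    refine isClosed_iInter fun i => isClosed_le (by fun_prop) ?_
    exact (continuous_apply i).comp (continuous_const.matrix_mulVec continuous_snd)
  have hbound : ∀ (s : ℝ) (y : ι → ℝ), y ∈ stdSimplex ℝ ι →
      (∀ i, s * y i ≤ (P *ᵥ y) i) → s ≤ c := by
    intro s y hy hs
    calc s = ∑ i, s * y i := by rw [← Finset.mul_sum, hy.2, mul_one]
      _ ≤ ∑ i, (P *ᵥ y) i := Finset.sum_le_sum fun i _ => hs i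
      _ ≤ c := by
        refine Finset.sum_le_sum fun i _ => Finset.sum_le_sum fun j _ => ?_
        refine mul_le_of_le_one_right (hP i j) ?_
        rw [← hy.2]
        exact Finset.single_le_sum (fun k _ => hy.1 k) (Finset.mem_univ j)
  have hne : K.Nonempty := by
    have i0 : ι := Classical.arbitrary ι
    have h1 := single_mem_stdSimplex ℝ i0
    refine ⟨(0, Pi.single i0 1), ⟨⟨⟨le_rfl, ?_⟩, h1⟩, fun i => ?_⟩⟩
    · exact Finset.sum_nonneg fun i _ => Finset.sum_nonneg fun j _ => hP i j
    · rw [zero_mul]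
      exact mulVec_apply_nonneg hP h1.1 i
  obtain ⟨⟨t, x⟩, hmem, hmax⟩ := hKc.exists_isMaxOn hne continuous_fst.continuousOn
  obtain ⟨⟨ht, hx⟩, htx⟩ := hmem
  refine ⟨t, x, ht.1, hx.1, ?_, htx, fun s y hs hy hy0 hsy => ?_⟩
  · rintro rfl
    have := hx.2
    simp at this
  · set S := ∑ i, y i with hS
    have hSpos : 0 < S := by
      obtain ⟨j, hj⟩ := Function.ne_iff.1 hy0
      exact Finset.sum_pos' (fun i _ => hy i)
        ⟨j, Finset.mem_univ _, lt_of_le_of_ne (hy j) (Ne.symm hj)⟩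
    have h1 : S⁻¹ • y ∈ stdSimplex ℝ ι := by
      refine ⟨fun i => mul_nonneg (by positivity) (hy i), ?_⟩
      simp only [Pi.smul_apply, smul_eq_mul, ← Finset.mul_sum]
      exact inv_mul_cancel₀ hSpos.ne'
    have h2 : ∀ i, s * (S⁻¹ • y) i ≤ (P *ᵥ (S⁻¹ • y)) i := by
      intro i
      rw [mulVec_smul, Pi.smul_apply, Pi.smul_apply, smul_eq_mul, smul_eq_mul, mul_left_comm]
      exact mul_le_mul_of_nonneg_left (hsy i) (by positivity)
    exact hmax (a := (s, S⁻¹ • y)) ⟨⟨⟨hs, hbound s _ h1 h2⟩, h1⟩, h2⟩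

/-- Perron's theorem: an irreducible matrix has a positive eigenvector. -/
theorem exists_pos_eigenvector [Nonempty ι] {P : Matrix ι ι ℝ} (hP : P.IsIrreducible) :
    ∃ (lam : ℝ) (φ : ι → ℝ), 0 < lam ∧ (∀ i, 0 < φ i) ∧ P *ᵥ φ = lam • φ := by
  have hnn := hP.nonneg
  have hirr := (isIrreducible_iff_exists_pow_pos hnn).1 hP
  choose n hn0 hn using hirr
  set M := ∑ i, ∑ j, n i j with hM
  -- The range contains every exponent `n i j`, so `B` is entrywise positive; it also commutes with
  -- `P`.
  set B := ∑ k ∈ Finset.range (M + 1), P ^ k with hB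
  have hBpos : ∀ i j, 0 < B i j := by
    intro i j
    rw [hB, Matrix.sum_apply]
    refine Finset.sum_pos' (fun k _ => pow_nonneg_apply hnn k i j) ⟨n i j, ?_, hn i j⟩
    rw [Finset.mem_range, Nat.lt_succ_iff]
    exact (Finset.single_le_sum (f := fun j => n i j) (fun _ _ => Nat.zero_le _)
      (Finset.mem_univ j)).trans
      (Finset.single_le_sum (f := fun i => ∑ j, n i j) (fun _ _ => Nat.zero_le _)
      (Finset.mem_univ i))
  have hcomm : P * B = B * P := by
    rw [hB, Finset.mul_sum, Finset.sum_mul]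
    exact Finset.sum_congr rfl fun k _ => by rw [← pow_succ, ← pow_succ']
  obtain ⟨t, x, ht, hx, hx0, htx, hmax⟩ := exists_collatzWielandt_max hnn
  -- Otherwise `B` turns the nonzero excess `P x - t x` into a strictly positive vector, and `B x`
  -- admits a constant larger than `t`.
  have heig : P *ᵥ x = t • x := by
    by_contra hne
    have hz0 : P *ᵥ x - t • x ≠ 0 := sub_ne_zero.2 hne
    have hzpos := mulVec_apply_pos hBpos (z := P *ᵥ x - t • x)
      (fun i => sub_nonneg.2 (htx i)) hz0
    have hypos := mulVec_apply_pos hBpos hx hx0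
    obtain ⟨ε, hε, hle⟩ := exists_pos_forall_le fun i => div_pos (hzpos i) (hypos i)
    have := hmax (t + ε) (B *ᵥ x) (by positivity) (fun i => (hypos i).le) (fun h => by
      have i0 : ι := Classical.arbitrary ι
      have := hypos i0
      rw [h] at this
      exact lt_irrefl _ this) (fun i => by
      have h1 := (le_div_iff₀ (hypos i)).1 (hle i)
      rw [mulVec_sub, mulVec_smul, mulVec_mulVec, ← hcomm, ← mulVec_mulVec] at h1
      simp only [Pi.sub_apply, Pi.smul_apply, smul_eq_mul] at h1
      linarith)
    linarith
  have hBx : B *ᵥ x = (∑ k ∈ Finset.range (M + 1), t ^ k) • x := by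
    rw [hB, Matrix.sum_mulVec, Finset.sum_smul]
    exact Finset.sum_congr rfl fun k _ => pow_mulVec_of_eigenvector heig k
  have hxpos : ∀ i, 0 < x i := by
    intro i
    have h1 := mulVec_apply_pos hBpos hx hx0 i
    rw [hBx, Pi.smul_apply, smul_eq_mul] at h1
    exact pos_of_mul_pos_right h1 (Finset.sum_nonneg fun k _ => pow_nonneg ht k)
  refine ⟨t, x, lt_of_le_of_ne ht ?_, hxpos, heig⟩
  rintro rfl
  have i0 : ι := Classical.arbitrary ι
  have h1 := pow_mulVec_of_eigenvector heig (n i0 i0)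
  rw [zero_pow (hn0 i0 i0).ne', zero_smul] at h1
  have h2 : 0 < (P ^ n i0 i0 *ᵥ x) i0 :=
    Finset.sum_pos' (fun k _ => mul_nonneg (pow_nonneg_apply hnn _ _ _) (hx k))
      ⟨i0, Finset.mem_univ _, mul_pos (hn i0 i0) (hxpos i0)⟩
  rw [h1] at h2
  exact lt_irrefl _ h2

/-- `j` is accessible from `i`. -/
def Accessible (A : Matrix ι ι ℝ) (i j : ι) : Prop := ∃ k : ℕ, 0 < (A ^ k) i j

/-- A Doeblin contraction. Accessibility is an equivalence relation, and every `K` steps the gap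
between class-wise lower and upper bounds of `x / φ` shrinks by a factor `1 - δ`. -/
theorem tendsto_pow_of_accessible {A : Matrix ι ι ℝ} (hA : ∀ i j, 0 ≤ A i j) {φ : ι → ℝ}
    (hφpos : ∀ i, 0 < φ i) (hφ : A *ᵥ φ = φ)
    (hsymm : ∀ i j, Accessible A i j → Accessible A j i) {K : ℕ}
    (hK : ∀ i j, Accessible A i j → 0 < (A ^ K) i j) :
    ∃ G : Matrix ι ι ℝ, Tendsto (fun n : ℕ => A ^ n) atTop (𝓝 G) := by
  classical
  have hpow : ∀ n, A ^ n *ᵥ φ = φ := fun n => by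
    rw [pow_mulVec_of_eigenvector (z := (1 : ℝ)) (by rw [hφ, one_smul]) n, one_pow, one_smul]
  have hinv : ∀ {a : ι → ℝ}, (∀ i j, Accessible A i j → a i = a j) → ∀ {x : ι → ℝ},
      (∀ i, a i * φ i ≤ x i) → ∀ n i, a i * φ i ≤ (A ^ n *ᵥ x) i := by
    intro a ha x hx n i
    have := le_mulVec_of_invariant (pow_nonneg_apply hA n) (hpow n)
      (fun i j h => ha i j ⟨n, h⟩) hx i i
    have h2 : 0 ≤ (A ^ n) i i * (x i - a i * φ i) :=
      mul_nonneg (pow_nonneg_apply hA n i i) (sub_nonneg.2 (hx i))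
    linarith
  let s : Setoid ι := ⟨Accessible A, fun i => ⟨0, by simp⟩, fun {i j} h => hsymm i j h,
    fun {i j k} h1 h2 => by
      obtain ⟨m, hm⟩ := h1
      obtain ⟨n, hn⟩ := h2
      exact ⟨m + n, pow_add_apply_pos hA hm hn⟩⟩
  -- A common representative of each class, towards which both bounds are moved.
  let c : ι → ι := fun i => (Quotient.mk s i).out
  have hc : ∀ i, Accessible A i (c i) := fun i => hsymm _ _ (Quotient.mk_out (s := s) i)
  have hcinv : ∀ i j, Accessible A i j → c i = c j := fun i j h =>
    congrArg Quotient.out (Quotient.sound (s := s) h)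
  rcases isEmpty_or_nonempty ι with hι | hι
  · exact ⟨0, tendsto_const_nhds.congr fun n => Subsingleton.elim _ _⟩
  obtain ⟨δ₀, hδ₀, hle₀⟩ := exists_pos_forall_le
    fun i => div_pos (mul_pos (hK i (c i) (hc i)) (hφpos (c i))) (hφpos i)
  -- `δ₀` bounds from below the weight that `A ^ K`, conjugated by `φ` into a stochastic matrix,
  -- puts on the representative. The cap `1 / 2` keeps `1 - δ` positive.
  set δ := min δ₀ (1 / 2) with hδdef
  have hδ : 0 < δ := lt_min hδ₀ (by norm_num)
  have hδ1 : δ ≤ 1 / 2 := min_le_right _ _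
  have hδle : ∀ i, δ * φ i ≤ (A ^ K) i (c i) * φ (c i) := fun i =>
    (le_div_iff₀ (hφpos i)).1 ((min_le_left _ _).trans (hle₀ i))
  have hstep : ∀ {a : ι → ℝ}, (∀ i j, Accessible A i j → a i = a j) → ∀ {x : ι → ℝ},
      (∀ i, a i * φ i ≤ x i) → ∀ i,
        (a i + δ * (x (c i) / φ (c i) - a i)) * φ i ≤ (A ^ K *ᵥ x) i := by
    intro a ha x hx i
    have h1 := le_mulVec_of_invariant (pow_nonneg_apply hA K) (hpow K)
      (fun i j h => ha i j ⟨K, h⟩) hx i (c i)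
    have h2 : 0 ≤ x (c i) / φ (c i) - a i := by
      rw [ha i (c i) (hc i), sub_nonneg, le_div_iff₀ (hφpos _)]
      exact hx _
    have h3 : x (c i) - a (c i) * φ (c i) = φ (c i) * (x (c i) / φ (c i) - a i) := by
      have := (hφpos (c i)).ne'
      rw [ha i (c i) (hc i)]
      field_simp
    have h4 := mul_le_mul_of_nonneg_right (hδle i) h2
    rw [h3] at h1
    nlinarith
  have hbd : ∀ x : ι → ℝ, ∃ C : ℝ, ∀ n : ℕ, ∃ a b : ι → ℝ,
      (∀ i j, Accessible A i j → a i = a j) ∧ (∀ i j, Accessible A i j → b i = b j) ∧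
      (∀ i, a i * φ i ≤ (A ^ (n * K) *ᵥ x) i) ∧ (∀ i, (A ^ (n * K) *ᵥ x) i ≤ b i * φ i) ∧
      ∀ i, b i - a i = (1 - δ) ^ n * C := by
    intro x
    obtain ⟨i0, hi0⟩ := Finite.exists_max fun i => |x i| / φ i
    set D := |x i0| / φ i0 with hD
    have hDi : ∀ i, |x i| ≤ D * φ i := fun i => (div_le_iff₀ (hφpos i)).1 (hi0 i)
    refine ⟨2 * D, fun n => ?_⟩
    induction n with
    | zero =>
      refine ⟨fun _ => -D, fun _ => D, fun _ _ _ => rfl, fun _ _ _ => rfl, fun i => ?_, fun i => ?_,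
        fun i => by ring⟩
      · simp only [zero_mul, pow_zero, one_mulVec]
        linarith [neg_abs_le (x i), hDi i]
      · simp only [zero_mul, pow_zero, one_mulVec]
        linarith [le_abs_self (x i), hDi i]
    | succ n ih =>
      obtain ⟨a, b, ha, hb, hax, hbx, hab⟩ := ih
      set y := A ^ (n * K) *ᵥ x with hy
      have hy' : A ^ ((n + 1) * K) *ᵥ x = A ^ K *ᵥ y := by
        rw [hy, mulVec_mulVec, ← pow_add]; ring_nf
      refine ⟨fun i => a i + δ * (y (c i) / φ (c i) - a i),
        fun i => b i + δ * (y (c i) / φ (c i) - b i), fun i j h => ?_, fun i j h => ?_,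
        fun i => ?_, fun i => ?_, fun i => ?_⟩
      · simp only [ha i j h, hcinv i j h]
      · simp only [hb i j h, hcinv i j h]
      · rw [hy']; exact hstep ha hax i
      · rw [hy']
        -- Upper bounds for `y` are lower bounds for `-y`.
        have := hstep (a := -b) (fun i j h => by simp [hb i j h]) (x := -y)
          (fun i => by simpa using hbx i) i
        rw [mulVec_neg] at this
        simp only [Pi.neg_apply, neg_div] at this
        linarith
      · have := hab i
        rw [pow_succ]
        linear_combination (1 - δ) * this
  have hcau : ∀ (x : ι → ℝ) (i : ι), CauchySeq fun n : ℕ => (A ^ n *ᵥ x) i := by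
    intro x i
    obtain ⟨C, hC⟩ := hbd x
    rw [Metric.cauchySeq_iff']
    intro ε hε
    have h0 : Tendsto (fun n : ℕ => (1 - δ) ^ n * C * φ i) atTop (𝓝 0) := by
      simpa using ((tendsto_pow_atTop_nhds_zero_of_lt_one (by linarith : (0 : ℝ) ≤ 1 - δ)
        (by linarith)).mul_const C).mul_const (φ i)
    obtain ⟨n, hn⟩ := (h0.eventually_lt_const hε).exists
    obtain ⟨a, b, ha, hb, hax, hbx, hab⟩ := hC n
    have hall : ∀ m ≥ n * K, a i * φ i ≤ (A ^ m *ᵥ x) i ∧ (A ^ m *ᵥ x) i ≤ b i * φ i := by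
      intro m hm
      have hm' : A ^ m *ᵥ x = A ^ (m - n * K) *ᵥ (A ^ (n * K) *ᵥ x) := by
        rw [mulVec_mulVec, ← pow_add, Nat.sub_add_cancel hm]
      rw [hm']
      refine ⟨hinv ha hax _ i, ?_⟩
      have := hinv (a := -b) (fun i j h => by simp [hb i j h]) (x := -(A ^ (n * K) *ᵥ x))
          (fun i => by simpa using hbx i) (m - n * K) i
      rw [mulVec_neg] at this
      simp only [Pi.neg_apply] at this
      linarith
    refine ⟨n * K, fun m hm => ?_⟩
    have h1 := hall m hm
    have h2 := hall (n * K) le_rfl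
    have h3 : (b i - a i) * φ i < ε := by rw [hab i]; exact hn
    rw [Real.dist_eq, abs_lt]
    constructor <;> linarith
  have hlim : ∀ i j, ∃ g, Tendsto (fun n : ℕ => (A ^ n) i j) atTop (𝓝 g) := by
    intro i j
    obtain ⟨g, hg⟩ := cauchySeq_tendsto_of_complete (hcau (Pi.single j 1) i)
    refine ⟨g, hg.congr fun n => ?_⟩
    rw [mulVec_single_one]
    rfl
  choose G hG using hlim
  exact ⟨Matrix.of G, tendsto_pi_nhds.2 fun i => tendsto_pi_nhds.2 fun j => hG i j⟩

/-- As `G φ = φ` is positive, each row `i` of `G` has a positive entry at some `k`, in the class of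
`i`. If `j` is in that class too, `G = G * A ^ K` transports positivity from `k` to `j`. -/
theorem limit_pos_iff_accessible {A G : Matrix ι ι ℝ} (hA : ∀ i j, 0 ≤ A i j) {φ : ι → ℝ}
    (hφpos : ∀ i, 0 < φ i) (hφ : A *ᵥ φ = φ)
    (hsymm : ∀ i j, Accessible A i j → Accessible A j i) {K : ℕ}
    (hK : ∀ i j, Accessible A i j → 0 < (A ^ K) i j)
    (hG : Tendsto (fun n : ℕ => A ^ n) atTop (𝓝 G)) :
    (∀ i j, 0 ≤ G i j) ∧ ∀ i j, 0 < G i j ↔ Accessible A i j := by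
  have hent : ∀ i j, Tendsto (fun n : ℕ => (A ^ n) i j) atTop (𝓝 (G i j)) := fun i j =>
    tendsto_pi_nhds.1 (tendsto_pi_nhds.1 hG i) j
  have hnn : ∀ i j, 0 ≤ G i j := fun i j =>
    ge_of_tendsto' (hent i j) fun n => pow_nonneg_apply hA n i j
  have hacc : ∀ i j, 0 < G i j → Accessible A i j := by
    intro i j h
    by_contra hn
    refine h.ne' (tendsto_nhds_unique (hent i j) (tendsto_const_nhds.congr fun n => ?_))
    by_contra h0
    exact hn ⟨n, lt_of_le_of_ne (pow_nonneg_apply hA n i j) h0⟩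
  have hG' : Tendsto (fun n : ℕ => ((1 : ℝ) ^ n)⁻¹ • A ^ n) atTop (𝓝 G) := by simpa using hG
  refine ⟨hnn, fun i j => ⟨hacc i j, fun h => ?_⟩⟩
  have hGφ : G *ᵥ φ = φ := mulVec_eq_self_of_eigenvector one_ne_zero hG' (by rw [hφ, one_smul])
  obtain ⟨k, hk⟩ : ∃ k, 0 < G i k := by
    by_contra! hall
    have h0 : (G *ᵥ φ) i = 0 :=
      Finset.sum_eq_zero fun k _ => mul_eq_zero_of_left (le_antisymm (hall k) (hnn i k)) _
    rw [hGφ] at h0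
    exact (hφpos i).ne' h0
  have hGA : G * A ^ K = G := by
    have h1 : G * A = G := by simpa using mul_eq_smul_of_tendsto' one_ne_zero hG'
    generalize K = m
    induction m with
    | zero => simp
    | succ m ih => rw [pow_succ, ← mul_assoc, ih, h1]
  have hkj : Accessible A k j := by
    obtain ⟨m, hm⟩ := hsymm _ _ (hacc i k hk)
    obtain ⟨n, hn⟩ := h
    exact ⟨m + n, pow_add_apply_pos hA hm hn⟩
  rw [← hGA]
  exact mul_apply_pos hnn (pow_nonneg_apply hA K) hk (hK k j hkj)

section Period

variable {N : ℕ} {P : Matrix (Fin N) (Fin N) ℝ} {h : ℕ}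

theorem HasPeriod.pos [Nonempty (Fin N)] (hh : HasPeriod P h) (hP : P.IsIrreducible) : 0 < h := by
  have i0 : Fin N := Classical.arbitrary _
  obtain ⟨n, hn0, hn⟩ := (isIrreducible_iff_exists_pow_pos hP.nonneg).1 hP i0 i0
  exact Nat.pos_of_dvd_of_pos ((hh i0).1 n hn0 hn) hn0

/-- Any path back from `j` closes a loop at `i`; as `h` divides both the loop and the outward path,
it divides the length of the return. -/
theorem HasPeriod.accessible_symm (hh : HasPeriod P h) (hP : P.IsIrreducible) {i j : Fin N}
    (hij : Accessible (P ^ h) i j) : Accessible (P ^ h) j i := by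
  obtain ⟨k, hk⟩ := hij
  obtain ⟨n, hn0, hn⟩ := (isIrreducible_iff_exists_pow_pos hP.nonneg).1 hP j i
  rw [← pow_mul] at hk
  have h1 := (hh i).1 (h * k + n) (by omega) (pow_add_apply_pos hP.nonneg hk hn)
  obtain ⟨l, rfl⟩ := (Nat.dvd_add_right (dvd_mul_right h k)).1 h1
  exact ⟨l, by rwa [← pow_mul]⟩

/-- Return times to `i` form an additive semigroup whose gcd divides `h`, so it contains all large
multiples of `h`; finiteness makes `K` uniform. -/
theorem HasPeriod.eventually_pos [Nonempty (Fin N)] (hh : HasPeriod P h) (hP : P.IsIrreducible) :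
    ∃ K, ∀ i j, Accessible (P ^ h) i j → 0 < ((P ^ h) ^ K) i j := by
  have hhpos := hh.pos hP
  have hdiag : ∀ i, ∃ K, ∀ k ≥ K, 0 < ((P ^ h) ^ k) i i := by
    intro i
    set s : Set ℕ := {n | 0 < n ∧ 0 < (P ^ n) i i} with hs
    obtain ⟨K, hK⟩ := Nat.exists_mem_closure_of_ge s
    refine ⟨K, fun k hk => ?_⟩
    have hd : Nat.setGcd s ∣ h := (hh i).2 _ fun n hn hn' => Nat.setGcd_dvd_of_mem ⟨hn, hn'⟩
    have hmem := hK (h * k) (hk.trans (Nat.le_mul_of_pos_left k hhpos)) (hd.mul_right k)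
    rw [← pow_mul]
    refine AddSubmonoid.closure_induction (motive := fun n _ => 0 < (P ^ n) i i)
      (fun n hn => hn.2) (by simp) (fun m n _ _ hm hn => pow_add_apply_pos hP.nonneg hm hn) hmem
  have hpair : ∀ i j, ∀ᶠ k in atTop, Accessible (P ^ h) i j → 0 < ((P ^ h) ^ k) i j := by
    intro i j
    by_cases hij : Accessible (P ^ h) i j
    · obtain ⟨l, hl⟩ := hij
      obtain ⟨K, hK⟩ := hdiag i
      filter_upwards [eventually_ge_atTop (K + l)] with k hk _
      have := pow_add_apply_pos (pow_nonneg_apply hP.nonneg h) (hK (k - l) (by omega)) hl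
      rwa [Nat.sub_add_cancel (by omega)] at this
    · exact Eventually.of_forall fun k hk => absurd hk hij
  exact (eventually_all.2 fun i => eventually_all.2 fun j => hpair i j).exists

/-- The Perron–Frobenius theorem for irreducible matrices of period `h`. -/
theorem perron_frobenius [Nonempty (Fin N)] (hP : P.IsIrreducible) (hh : HasPeriod P h) :
    ∃ (lam : ℝ) (φ : Fin N → ℝ) (G : Matrix (Fin N) (Fin N) ℝ), 0 < lam ∧ (∀ i, 0 < φ i) ∧
      P *ᵥ φ = lam • φ ∧
      Tendsto (fun n : ℕ => ((lam ^ h) ^ n)⁻¹ • (P ^ h) ^ n) atTop (𝓝 G) ∧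
      (∀ i j, 0 ≤ G i j) ∧ ∀ i j, 0 < G i j ↔ Accessible (P ^ h) i j := by
  obtain ⟨lam, φ, hlam, hφpos, hφ⟩ := exists_pos_eigenvector hP
  obtain ⟨K, hK⟩ := hh.eventually_pos hP
  have hl : 0 < lam ^ h := by positivity
  set A := (lam ^ h)⁻¹ • P ^ h with hA
  have hApow : ∀ n, A ^ n = ((lam ^ h) ^ n)⁻¹ • (P ^ h) ^ n := fun n => by
    rw [hA, smul_pow, inv_pow]
  have hApos : ∀ n i j, 0 < (A ^ n) i j ↔ 0 < ((P ^ h) ^ n) i j := fun n i j => by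
    rw [hApow, Matrix.smul_apply, smul_eq_mul]
    exact mul_pos_iff_of_pos_left (by positivity)
  have hacc : ∀ i j, Accessible A i j ↔ Accessible (P ^ h) i j := fun i j =>
    exists_congr fun n => hApos n i j
  have hAnn : ∀ i j, 0 ≤ A i j := fun i j =>
    mul_nonneg (by positivity) (pow_nonneg_apply hP.nonneg h i j)
  have hAφ : A *ᵥ φ = φ := by
    rw [hA, smul_mulVec, pow_mulVec_of_eigenvector hφ, smul_smul, inv_mul_cancel₀ hl.ne', one_smul]
  have hsymm : ∀ i j, Accessible A i j → Accessible A j i := fun i j hij =>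
    (hacc j i).2 (hh.accessible_symm hP ((hacc i j).1 hij))
  have hK' : ∀ i j, Accessible A i j → 0 < (A ^ K) i j := fun i j hij =>
    (hApos K i j).2 (hK i j ((hacc i j).1 hij))
  obtain ⟨G, hG⟩ := tendsto_pow_of_accessible hAnn hφpos hAφ hsymm hK'
  obtain ⟨h1, h2⟩ := limit_pos_iff_accessible hAnn hφpos hAφ hsymm hK' hG
  exact ⟨lam, φ, G, hlam, hφpos, hφ, hG.congr hApow, h1, fun i j => (h2 i j).trans (hacc i j)⟩

/-- If `P ^ k` is positive, both `k` and `k + 1` are return times. -/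
theorem hasPeriod_one_of_isPrimitive (hP : P.IsPrimitive) : HasPeriod P 1 := by
  refine fun i => ⟨fun n _ _ => one_dvd n, fun d hd => ?_⟩
  obtain ⟨k, hk0, hk⟩ := hP.exists_pos_pow
  obtain ⟨j, hj⟩ : ∃ j, 0 < P i j := by
    by_contra! hall
    obtain ⟨m, rfl⟩ : ∃ m, k = m + 1 := ⟨k - 1, by omega⟩
    have h0 : (P ^ (m + 1)) i i = 0 := by
      rw [pow_succ', mul_apply]
      exact Finset.sum_eq_zero fun j _ => by rw [le_antisymm (hall j) (hP.nonneg i j), zero_mul]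
    exact (hk i i).ne' h0
  have h1 : 0 < (P ^ (1 + k)) i i :=
    pow_add_apply_pos hP.nonneg (by rwa [pow_one]) (hk j i)
  exact (Nat.dvd_add_left (hd k hk0 (hk i i))).1 (hd (1 + k) (by omega) h1)

end Period
end Perron

/-! ### Excursions of the chain and the renewal property -/

section Chain

/-- The trajectory of a process up to time `t`, most recent symbol first. -/
def historyOf {Ω S : Type*} (X : ℤ → Ω → S) (t : ℤ) (ω : Ω) : ℕ → S := fun i => X (t - (i : ℕ)) ω

/-- The transitions that avoid the distinguished symbol. -/
def taboo {N : ℕ} (Q : Matrix (Fin (N + 1)) (Fin (N + 1)) ℝ) :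
    Matrix (Fin (N + 1)) (Fin (N + 1)) ℝ :=
  Matrix.of fun a b => if b = 0 then 0 else Q a b

variable {N : ℕ} {Q : Matrix (Fin (N + 1)) (Fin (N + 1)) ℝ}

theorem taboo_apply_zero (a : Fin (N + 1)) : taboo Q a 0 = 0 := by simp [taboo]

theorem taboo_apply_succ (a : Fin (N + 1)) (j : Fin N) : taboo Q a j.succ = Q a j.succ := by
  simp [taboo, Fin.succ_ne_zero]

theorem taboo_pow_succ_succ (n : ℕ) (i j : Fin N) :
    (taboo Q ^ n) i.succ j.succ = (blockP Q ^ n) i j := by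
  induction n generalizing i j with
  | zero => simp [one_apply]
  | succ n ih =>
    rw [pow_succ', mul_apply, Fin.sum_univ_succ, taboo_apply_zero, zero_mul, zero_add, pow_succ',
      mul_apply]
    exact Finset.sum_congr rfl fun k _ => by rw [taboo_apply_succ, ih]; rfl

theorem taboo_pow_succ_zero (n : ℕ) (i : Fin N) : (taboo Q ^ n) i.succ 0 = 0 := by
  cases n with
  | zero => simp [one_apply, Fin.succ_ne_zero]
  | succ n =>
    rw [pow_succ, mul_apply]
    exact Finset.sum_eq_zero fun k _ => by rw [taboo_apply_zero, mul_zero]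

theorem taboo_pow_zero_zero (n : ℕ) : (taboo Q ^ (n + 1)) 0 0 = 0 := by
  rw [pow_succ, mul_apply]
  exact Finset.sum_eq_zero fun k _ => by rw [taboo_apply_zero, mul_zero]

theorem taboo_pow_zero_succ (n : ℕ) (j : Fin N) :
    (taboo Q ^ (n + 1)) 0 j.succ = (rowV Q ᵥ* blockP Q ^ n) j := by
  rw [pow_succ', mul_apply, Fin.sum_univ_succ, taboo_apply_zero, zero_mul, zero_add]
  exact Finset.sum_congr rfl fun k _ => by rw [taboo_apply_succ, taboo_pow_succ_succ]; rfl

/-- Two cylinders that meet are nested. -/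
theorem isPiSystem_cylinders (S : Type*) :
    IsPiSystem {s : Set (ℕ → S) | ∃ (x : ℕ → S) (n : ℕ), s = PiNat.cylinder x n} := by
  rintro _ ⟨x, m, rfl⟩ _ ⟨y, n, rfl⟩ ⟨z, hz1, hz2⟩
  rw [← PiNat.mem_cylinder_iff_eq.1 hz1, ← PiNat.mem_cylinder_iff_eq.1 hz2]
  rcases le_total m n with h | h
  · exact ⟨z, n, Set.inter_eq_right.2 (PiNat.cylinder_anti z h)⟩
  · exact ⟨z, m, Set.inter_eq_left.2 (PiNat.cylinder_anti z h)⟩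

theorem generateFrom_cylinders (S : Type*) [MeasurableSpace S] [Finite S]
    [MeasurableSingletonClass S] :
    (inferInstance : MeasurableSpace (ℕ → S)) =
      MeasurableSpace.generateFrom
        {s : Set (ℕ → S) | ∃ (x : ℕ → S) (n : ℕ), s = PiNat.cylinder x n} := by
  let : TopologicalSpace S := ⊥
  have : DiscreteTopology S := ⟨rfl⟩
  have : BorelSpace S := ⟨by
    rw [borel_eq_top_of_discrete]
    exact eq_top_iff.2 fun s _ => s.toFinite.measurableSet⟩
  rw [← (PiNat.isTopologicalBasis_cylinders (fun _ : ℕ => S)).borel_eq_generateFrom]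
  exact BorelSpace.measurable_eq

/-- Trajectories in `B` up to time `T - k` with `X (T - k) = a`, followed by `k` steps that avoid
the distinguished symbol; seen from time `T`. -/
def excursionSet (B : Set (ℕ → Fin (N + 1))) (a : Fin (N + 1)) (k : ℕ) : Set (ℕ → Fin (N + 1)) :=
  {x | (fun i => x (k + i)) ∈ B ∧ x k = a ∧ ∀ i < k, x i ≠ 0}

theorem measurableSet_excursionSet {B : Set (ℕ → Fin (N + 1))} (hB : MeasurableSet B)
    (a : Fin (N + 1)) (k : ℕ) : MeasurableSet (excursionSet B a k) := by
  have : excursionSet B a k = (fun x i => x (k + i)) ⁻¹' B ∩ ((fun x => x k) ⁻¹' {a} ∩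
      ⋂ i, ⋂ (_ : i < k), ((fun x : ℕ → Fin (N + 1) => x i) ⁻¹' {0})ᶜ) := by
    ext x; simp [excursionSet]
  rw [this]
  refine MeasurableSet.inter ?_ (MeasurableSet.inter ?_ ?_)
  · exact (measurable_pi_lambda _ fun i => measurable_pi_apply (k + i)) hB
  · exact (measurable_pi_apply k) (measurableSet_singleton a)
  · exact MeasurableSet.iInter fun i => MeasurableSet.iInter fun _ =>
      MeasurableSet.compl ((measurable_pi_apply i) (measurableSet_singleton 0))

theorem measurableSet_lastOneAt (k : ℕ) : MeasurableSet {a : Past (Fin 2) | LastOneAt a k} := by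
  have : {a : Past (Fin 2) | LastOneAt a k} =
      {a | a k = 1} ∩ ⋂ i, ⋂ (_ : i < k), {a | a i = 0} := by
    ext x; simp [LastOneAt]
  rw [this]
  exact ((measurable_pi_apply k) (measurableSet_singleton 1)).inter
    (MeasurableSet.iInter fun i => MeasurableSet.iInter fun _ =>
      (measurable_pi_apply i) (measurableSet_singleton 0))

theorem aggregation_eq_one {a : Fin (N + 1)} : aggregation a = 1 ↔ a = 0 := by
  unfold aggregation; split_ifs with h <;> simp [h]

theorem aggregation_eq_zero {a : Fin (N + 1)} : aggregation a = 0 ↔ a ≠ 0 := by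
  unfold aggregation; split_ifs with h <;> simp [h]

variable {Ω : Type*} {X : ℤ → Ω → Fin (N + 1)}

theorem historyOf_mem_excursionSet (T : ℤ) (B : Set (ℕ → Fin (N + 1))) (a : Fin (N + 1)) (k : ℕ)
    (ω : Ω) : historyOf X T ω ∈ excursionSet B a k ↔
      historyOf X (T - k) ω ∈ B ∧ X (T - k) ω = a ∧ ∀ i < k, X (T - (i : ℕ)) ω ≠ 0 := by
  have : (fun i => historyOf X T ω (k + i)) = historyOf X (T - k) ω := by
    funext i
    simp only [historyOf, Nat.cast_add]
    congr 1
    ring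
  simp only [excursionSet, Set.mem_ofPred_eq, this]
  rfl

theorem historyOf_mem_excursionSet_succ (T : ℤ) (B : Set (ℕ → Fin (N + 1))) (a : Fin (N + 1))
    (k : ℕ) (ω : Ω) : historyOf X (T + 1) ω ∈ excursionSet B a (k + 1) ↔
      historyOf X T ω ∈ excursionSet B a k ∧ X (T + 1) ω ≠ 0 := by
  rw [historyOf_mem_excursionSet, historyOf_mem_excursionSet]
  have e : T + 1 - ((k + 1 : ℕ) : ℤ) = T - k := by push_cast; ring
  rw [e]
  constructor
  · rintro ⟨h1, h2, h3⟩
    refine ⟨⟨h1, h2, fun i hi => ?_⟩, by simpa using h3 0 (by omega)⟩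
    have := h3 (i + 1) (by omega)
    have e2 : T + 1 - ((i + 1 : ℕ) : ℤ) = T - i := by push_cast; ring
    rwa [e2] at this
  · rintro ⟨⟨h1, h2, h3⟩, h4⟩
    refine ⟨h1, h2, fun i hi => ?_⟩
    rcases i with _ | i
    · simpa using h4
    · have e2 : T + 1 - ((i + 1 : ℕ) : ℤ) = T - i := by push_cast; ring
      rw [e2]
      exact h3 i (by omega)

theorem pastOf_image (ω : Ω) (i : ℕ) :
    pastOf (image X) ω i = aggregation (historyOf X (-1) ω i) := by
  simp only [pastOf, image, historyOf]
  congr 2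
  ring

theorem lastOneAt_pastOf_iff (ω : Ω) (k : ℕ) : LastOneAt (pastOf (image X) ω) k ↔
    historyOf X (-1) ω ∈ excursionSet Set.univ 0 k := by
  simp only [LastOneAt, pastOf_image, aggregation_eq_one, aggregation_eq_zero, excursionSet,
    Set.mem_ofPred_eq, Set.mem_univ, true_and]

/-- Once the last `1` is located, the `k` recent symbols are zero, so an event of the binary past
becomes a condition on the trajectory up to the last visit. -/
theorem pastOf_mem_and_lastOneAt_iff (B : Set (Past (Fin 2))) (ω : Ω) (k : ℕ) :
    (pastOf (image X) ω ∈ B ∧ LastOneAt (pastOf (image X) ω) k) ↔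
      historyOf X (-1) ω ∈ excursionSet
        {x | (fun i => if i < k then 0 else aggregation (x (i - k))) ∈ B} 0 k := by
  rw [lastOneAt_pastOf_iff]
  simp only [excursionSet, Set.mem_ofPred_eq, Set.mem_univ, true_and]
  refine and_congr_left fun h => ?_
  have : pastOf (image X) ω =
      fun i => if i < k then 0 else aggregation (historyOf X (-1) ω (k + (i - k))) := by
    funext i
    rw [pastOf_image]
    split_ifs with hi
    · exact aggregation_eq_zero.2 (h.2 i hi)
    · rw [Nat.add_sub_cancel' (not_lt.1 hi)]
  rw [← this]

theorem image_zero_eq_one_iff (ω : Ω) : image X 0 ω = 1 ↔ X (-1 + 1) ω = 0 := by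
  rw [image, aggregation_eq_one]; norm_num

variable [MeasurableSpace Ω] {μ : Measure Ω}

theorem IsStationaryMarkovChain.measurable_historyOf (hX : IsStationaryMarkovChain μ Q X) (t : ℤ) :
    Measurable (historyOf X t) := measurable_pi_lambda _ fun _ => hX.measurable _

theorem IsStationaryMarkovChain.measurableSet_eq (hX : IsStationaryMarkovChain μ Q X) (t : ℤ)
    (a : Fin (N + 1)) : MeasurableSet {ω | X t ω = a} := hX.measurable t (measurableSet_singleton a)

variable [IsProbabilityMeasure μ]

/-- The Markov property with respect to the whole past. -/
theorem IsStationaryMarkovChain.markov_history (hX : IsStationaryMarkovChain μ Q X)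
    (hQ : ∀ a b, 0 ≤ Q a b) (t : ℤ)
    {B : Set (ℕ → Fin (N + 1))} (hB : MeasurableSet B) (a b : Fin (N + 1)) :
    μ.real {ω | historyOf X t ω ∈ B ∧ X t ω = a ∧ X (t + 1) ω = b} =
      μ.real {ω | historyOf X t ω ∈ B ∧ X t ω = a} * Q a b := by
  have hm := hX.measurable_historyOf t
  have ha := hX.measurableSet_eq t a
  have hb := hX.measurableSet_eq (t + 1) b
  have hcyl : ∀ (x : ℕ → Fin (N + 1)) (n : ℕ),
      μ.real {ω | historyOf X t ω ∈ PiNat.cylinder x n ∧ X t ω = a ∧ X (t + 1) ω = b} =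
        μ.real {ω | historyOf X t ω ∈ PiNat.cylinder x n ∧ X t ω = a} * Q a b := by
    intro x n
    rcases n with _ | n
    · have := hX.markov t 0 (fun _ => a) b
      simp only [nonpos_iff_eq_zero, forall_eq, Nat.cast_zero, sub_zero] at this
      simp only [PiNat.cylinder_zero, Set.mem_univ, true_and]
      rw [← this]
      simp only [and_comm]
    · by_cases hxa : x 0 = a
      · have := hX.markov t n x b
        rw [hxa] at this
        convert this using 2
        · congr 1
          ext ω
          simp only [Set.mem_ofPred_eq, PiNat.cylinder, historyOf, Nat.lt_succ_iff]
          constructor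
          · exact fun h => ⟨h.2.2, h.1⟩
          · refine fun h => ⟨h.2, ?_, h.1⟩
            simpa [hxa] using h.2 0 (Nat.zero_le n)
        · congr 1
          ext ω
          simp only [Set.mem_ofPred_eq, PiNat.cylinder, historyOf, Nat.lt_succ_iff]
          constructor
          · exact fun h => h.1
          · refine fun h => ⟨h, ?_⟩
            simpa [hxa] using h 0 (Nat.zero_le n)
      · have h0 : ∀ ω, historyOf X t ω ∈ PiNat.cylinder x (n + 1) → X t ω ≠ a := by
          intro ω hω h
          have := hω 0 (Nat.succ_pos n)
          simp only [historyOf, Nat.cast_zero, sub_zero] at this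
          exact hxa (by rw [← this, h])
        have e1 : {ω | historyOf X t ω ∈ PiNat.cylinder x (n + 1) ∧ X t ω = a ∧
            X (t + 1) ω = b} = ∅ := by
          exact Set.eq_empty_of_forall_notMem fun ω h => h0 ω h.1 h.2.1
        have e2 : {ω | historyOf X t ω ∈ PiNat.cylinder x (n + 1) ∧ X t ω = a} = ∅ := by
          exact Set.eq_empty_of_forall_notMem fun ω h => h0 ω h.1 h.2
        rw [e1, e2]
        simp
  -- The hypothesis on finite words gives equality on cylinders, a generating π-system, and so the
  -- two finite measures coincide.
  have hν : (μ.restrict ({ω | X t ω = a} ∩ {ω | X (t + 1) ω = b})).map (historyOf X t) =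
      (Q a b).toNNReal • (μ.restrict {ω | X t ω = a}).map (historyOf X t) := by
    have key : ∀ C : Set (ℕ → Fin (N + 1)), MeasurableSet C →
        μ.real {ω | historyOf X t ω ∈ C ∧ X t ω = a ∧ X (t + 1) ω = b} =
          μ.real {ω | historyOf X t ω ∈ C ∧ X t ω = a} * Q a b →
        (μ.restrict ({ω | X t ω = a} ∩ {ω | X (t + 1) ω = b})).map (historyOf X t) C =
      ((Q a b).toNNReal • (μ.restrict {ω | X t ω = a}).map (historyOf X t)) C := by
      intro C hC h
      rw [Measure.smul_apply, Measure.map_apply hm hC, Measure.map_apply hm hC,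
        Measure.restrict_apply (hm hC), Measure.restrict_apply (hm hC)]
      have h' := congrArg ENNReal.ofReal h
      rw [ENNReal.ofReal_mul measureReal_nonneg, ofReal_measureReal, ofReal_measureReal] at h'
      rw [mul_comm] at h'
      exact h'
    refine ext_of_generate_finite _ (generateFrom_cylinders (Fin (N + 1)))
      (isPiSystem_cylinders _) ?_ (key _ MeasurableSet.univ (by simpa using hcyl (fun _ => a) 0))
    rintro _ ⟨x, n, rfl⟩
    refine key _ ?_ (hcyl x n)
    have hc := MeasurableSpace.measurableSet_generateFrom
      (s := {s : Set (ℕ → Fin (N + 1)) | ∃ x n, s = PiNat.cylinder x n}) ⟨x, n, rfl⟩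
    rwa [← generateFrom_cylinders (Fin (N + 1))] at hc
  have h := congrArg (fun ν : Measure (ℕ → Fin (N + 1)) => ν.real B) hν
  simp only [Measure.real, Measure.smul_apply] at h
  rw [Measure.map_apply hm hB, Measure.map_apply hm hB, Measure.restrict_apply (hm hB),
    Measure.restrict_apply (hm hB), ENNReal.smul_def, smul_eq_mul, ENNReal.toReal_mul,
    ENNReal.coe_toReal, Real.coe_toNNReal _ (hQ a b), mul_comm] at h
  exact h

theorem measureReal_eq_sum_fiber {S : Type*} [Fintype S] {Z : Ω → S}
    (hZ : ∀ c, MeasurableSet {ω | Z ω = c}) (F : Set Ω) :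
    μ.real F = ∑ c, μ.real {ω | ω ∈ F ∧ Z ω = c} := by
  have h := measureReal_biUnion_finset (μ := μ.restrict F) (s := Finset.univ)
    (f := fun c => {ω | Z ω = c}) (fun c _ d _ hcd => Set.disjoint_left.2 fun ω h1 h2 =>
      hcd (h1.symm.trans h2)) (fun c _ => hZ c)
  have hu : (⋃ c ∈ (Finset.univ : Finset S), {ω | Z ω = c}) = Set.univ := by
    ext ω; simp
  rw [hu, measureReal_restrict_apply MeasurableSet.univ, Set.univ_inter] at h
  rw [h]
  refine Finset.sum_congr rfl fun c _ => ?_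
  rw [measureReal_restrict_apply (hZ c), Set.inter_comm]
  rfl

theorem IsStationaryMarkovChain.step (hX : IsStationaryMarkovChain μ Q X)
    (hQ : ∀ a b, 0 ≤ Q a b) (t : ℤ)
    {B : Set (ℕ → Fin (N + 1))} (hB : MeasurableSet B) (b : Fin (N + 1)) :
    μ.real {ω | historyOf X t ω ∈ B ∧ X (t + 1) ω = b} =
      ∑ c, μ.real {ω | historyOf X t ω ∈ B ∧ X t ω = c} * Q c b := by
  rw [measureReal_eq_sum_fiber (Z := X t) (hX.measurableSet_eq t)]
  refine Finset.sum_congr rfl fun c _ => ?_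
  rw [← hX.markov_history hQ t hB]
  congr 1
  ext ω
  simp only [Set.mem_ofPred_eq]
  tauto

/-- Each step avoiding the distinguished symbol contributes a factor `taboo Q`, while the event `B`
before the excursion enters only through the initial mass. -/
theorem IsStationaryMarkovChain.excursion (hX : IsStationaryMarkovChain μ Q X)
    (hQ : ∀ a b, 0 ≤ Q a b)
    {B : Set (ℕ → Fin (N + 1))} (hB : MeasurableSet B) (a : Fin (N + 1)) (k : ℕ) (T : ℤ)
    (b : Fin (N + 1)) :
    μ.real {ω | historyOf X T ω ∈ excursionSet B a k ∧ X T ω = b} =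
      μ.real {ω | historyOf X (T - k) ω ∈ B ∧ X (T - k) ω = a} * (taboo Q ^ k) a b := by
  induction k generalizing T b with
  | zero =>
    simp only [historyOf_mem_excursionSet, Nat.cast_zero, sub_zero, pow_zero, one_apply]
    split_ifs with hab
    · subst hab
      rw [mul_one]
      congr 1
      ext ω
      simp only [Set.mem_ofPred_eq, not_lt_zero, false_imp_iff, implies_true, and_true]
      tauto
    · rw [mul_zero]
      convert measureReal_empty (μ := μ)
      ext ω
      simp only [Set.mem_ofPred_eq, Set.mem_empty_iff_false, iff_false]
      rintro ⟨⟨-, h1, -⟩, h2⟩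
      exact hab (h1.symm.trans h2)
  | succ k ih =>
    obtain ⟨T, rfl⟩ : ∃ T', T = T' + 1 := ⟨T - 1, by ring⟩
    have e : T + 1 - ((k + 1 : ℕ) : ℤ) = T - k := by push_cast; ring
    simp only [historyOf_mem_excursionSet_succ, e]
    rw [pow_succ, mul_apply]
    by_cases hb : b = 0
    · subst hb
      simp only [taboo_apply_zero, mul_zero, Finset.sum_const_zero]
      convert measureReal_empty (μ := μ)
      ext ω
      simp only [Set.mem_ofPred_eq, Set.mem_empty_iff_false, iff_false]
      rintro ⟨⟨-, h1⟩, h2⟩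
      exact h1 h2
    · have hset : {ω | (historyOf X T ω ∈ excursionSet B a k ∧ X (T + 1) ω ≠ 0) ∧
          X (T + 1) ω = b} = {ω | historyOf X T ω ∈ excursionSet B a k ∧ X (T + 1) ω = b} := by
        ext ω
        simp only [Set.mem_ofPred_eq]
        constructor
        · tauto
        · rintro ⟨h1, h2⟩
          exact ⟨⟨h1, by rw [h2]; exact hb⟩, h2⟩
      rw [hset, hX.step hQ T (measurableSet_excursionSet hB a k), Finset.mul_sum]
      refine Finset.sum_congr rfl fun c _ => ?_
      rw [ih, mul_assoc]
      simp [taboo, hb]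

theorem IsStationaryMarkovChain.excursion_sum (hX : IsStationaryMarkovChain μ Q X)
    (hQ : ∀ a b, 0 ≤ Q a b)
    {B : Set (ℕ → Fin (N + 1))} (hB : MeasurableSet B) (a : Fin (N + 1)) (k : ℕ) (T : ℤ) :
    μ.real {ω | historyOf X T ω ∈ excursionSet B a k} =
      μ.real {ω | historyOf X (T - k) ω ∈ B ∧ X (T - k) ω = a} * ∑ b, (taboo Q ^ k) a b := by
  rw [measureReal_eq_sum_fiber (Z := X T) (hX.measurableSet_eq T), Finset.mul_sum]
  exact Finset.sum_congr rfl fun b _ => hX.excursion hQ hB a k T b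

theorem IsStationaryMarkovChain.excursion_step (hX : IsStationaryMarkovChain μ Q X)
    (hQ : ∀ a b, 0 ≤ Q a b)
    {B : Set (ℕ → Fin (N + 1))} (hB : MeasurableSet B) (a : Fin (N + 1)) (k : ℕ) (T : ℤ)
    (b : Fin (N + 1)) :
    μ.real {ω | historyOf X T ω ∈ excursionSet B a k ∧ X (T + 1) ω = b} =
      μ.real {ω | historyOf X (T - k) ω ∈ B ∧ X (T - k) ω = a} * (taboo Q ^ k * Q) a b := by
  rw [hX.step hQ T (measurableSet_excursionSet hB a k), mul_apply, Finset.mul_sum]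
  exact Finset.sum_congr rfl fun c _ => by rw [hX.excursion hQ hB a k T c, mul_assoc]

/-- Given the position of the last `1`, the next symbol is independent of the rest of the past. -/
theorem IsStationaryMarkovChain.renewal (hX : IsStationaryMarkovChain μ Q X)
    (hQ : ∀ a b, 0 ≤ Q a b) {B : Set (Past (Fin 2))} (hB : MeasurableSet B) (k : ℕ) :
    μ.real {ω | (pastOf (image X) ω ∈ B ∧ LastOneAt (pastOf (image X) ω) k) ∧ image X 0 ω = 1} =
      renewalProb μ (image X) k *
        μ.real {ω | pastOf (image X) ω ∈ B ∧ LastOneAt (pastOf (image X) ω) k} := by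
  by_cases h0 : μ.real {ω | LastOneAt (pastOf (image X) ω) k} = 0
  · have h1 : μ.real {ω | pastOf (image X) ω ∈ B ∧ LastOneAt (pastOf (image X) ω) k} = 0 :=
      le_antisymm (h0 ▸ measureReal_mono fun ω h => h.2) measureReal_nonneg
    have h2 : μ.real {ω | (pastOf (image X) ω ∈ B ∧ LastOneAt (pastOf (image X) ω) k) ∧
        image X 0 ω = 1} = 0 :=
      le_antisymm (h0 ▸ measureReal_mono fun ω h => h.1.2) measureReal_nonneg
    rw [h1, h2, mul_zero]
  · have hB' : MeasurableSet {x : ℕ → Fin (N + 1) |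
        (fun i => if i < k then 0 else aggregation (x (i - k))) ∈ B} := by
      refine (measurable_pi_lambda _ fun i => ?_ :
        Measurable fun (x : ℕ → Fin (N + 1)) (i : ℕ) =>
          if i < k then 0 else aggregation (x (i - k))) hB
      split_ifs
      · exact measurable_const
      · exact (measurable_of_finite aggregation).comp (measurable_pi_apply _)
    have e1 : renewalProb μ (image X) k = μ.real {ω | historyOf X (-1) ω ∈
        excursionSet Set.univ 0 k ∧ X (-1 + 1) ω = 0} /
        μ.real {ω | LastOneAt (pastOf (image X) ω) k} := by
      simp only [renewalProb, image_zero_eq_one_iff, lastOneAt_pastOf_iff, and_comm]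
    rw [e1, div_mul_eq_mul_div, eq_div_iff h0]
    simp only [pastOf_mem_and_lastOneAt_iff, image_zero_eq_one_iff]
    simp only [lastOneAt_pastOf_iff]
    -- The excursion factors are the same with and without the event `B`, so the two products agree.
    rw [hX.excursion_step hQ hB', hX.excursion_step hQ MeasurableSet.univ, hX.excursion_sum hQ hB',
      hX.excursion_sum hQ MeasurableSet.univ]
    ring

end Chain

/-! ### The stationary law and the conditional law given the binary past -/

section Stationary

variable {N : ℕ} {Q : Matrix (Fin (N + 1)) (Fin (N + 1)) ℝ} {Ω : Type*} [MeasurableSpace Ω]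
  {μ : Measure Ω} {X : ℤ → Ω → Fin (N + 1)}

theorem IsStationaryMarkovChain.measureReal_eq (hX : IsStationaryMarkovChain μ Q X) (t : ℤ)
    (a : Fin (N + 1)) : μ.real {ω | X t ω = a} = μ.real {ω | X 0 ω = a} := by
  have := hX.stationary 1 t fun _ => a
  simp only [Fin.forall_fin_one, Fin.val_zero, Nat.cast_zero, add_zero] at this
  rw [Measure.real, this, Measure.real]

theorem IsStationaryMarkovChain.measurable_pastOf_image (hX : IsStationaryMarkovChain μ Q X) :
    Measurable (pastOf (image X)) :=
  measurable_pi_lambda _ fun _ => (measurable_of_finite aggregation).comp (hX.measurable _)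

theorem IsStationaryMarkovChain.measurableSet_image_eq (hX : IsStationaryMarkovChain μ Q X)
    (x : Fin 2) : MeasurableSet (image X 0 ⁻¹' {x}) :=
  ((measurable_of_finite aggregation).comp (hX.measurable 0)) (measurableSet_singleton x)

variable [IsProbabilityMeasure μ]

theorem IsStationaryMarkovChain.sum_measureReal_eq_one (hX : IsStationaryMarkovChain μ Q X) :
    ∑ a, μ.real {ω | X 0 ω = a} = 1 := by
  have := measureReal_eq_sum_fiber (μ := μ) (Z := X 0) (hX.measurableSet_eq 0) Set.univ
  simpa using this.symm

theorem IsStationaryMarkovChain.sum_mul_eq (hX : IsStationaryMarkovChain μ Q X)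
    (hQ : ∀ a b, 0 ≤ Q a b) (b : Fin (N + 1)) :
    ∑ a, μ.real {ω | X 0 ω = a} * Q a b = μ.real {ω | X 0 ω = b} := by
  have h := hX.step hQ 0 MeasurableSet.univ b
  simp only [Set.mem_univ, true_and] at h
  rw [← h, hX.measureReal_eq]

theorem IsStationaryMarkovChain.vecMul_blockP (hX : IsStationaryMarkovChain μ Q X)
    (hQ : ∀ a b, 0 ≤ Q a b) :
    (fun i : Fin N => μ.real {ω | X 0 ω = i.succ}) ᵥ* blockP Q =
      (fun i : Fin N => μ.real {ω | X 0 ω = i.succ}) - μ.real {ω | X 0 ω = 0} • rowV Q := by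
  funext j
  have h := hX.sum_mul_eq hQ j.succ
  rw [Fin.sum_univ_succ] at h
  simp only [Pi.sub_apply, Pi.smul_apply, smul_eq_mul, rowV, ← h]
  rw [add_sub_cancel_left]
  rfl

/-- If this mass were zero, the law `v` on the other states would be `P`-invariant and vanish at a
state with `W i > 0`; irreducibility would spread the zero to every state, against total mass 1. -/
theorem IsStationaryMarkovChain.measureReal_zero_pos (hX : IsStationaryMarkovChain μ Q X)
    (hQ : ∀ a b, 0 ≤ Q a b) (hP : (blockP Q).IsIrreducible) (hW : colW Q ≠ 0) :
    0 < μ.real {ω | X 0 ω = 0} := by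
  refine lt_of_le_of_ne measureReal_nonneg fun h0 => ?_
  set v : Fin N → ℝ := fun i => μ.real {ω | X 0 ω = i.succ} with hv
  have hv1 : v ᵥ* blockP Q = (1 : ℝ) • v := by
    rw [hX.vecMul_blockP hQ, ← h0, zero_smul, sub_zero, one_smul]
  obtain ⟨i, hi⟩ := Function.ne_iff.1 hW
  have hi' : 0 < Q i.succ 0 := lt_of_le_of_ne (hQ _ _) (Ne.symm hi)
  have hvi : v i = 0 := by
    have h := hX.sum_mul_eq hQ 0
    rw [← h0] at h
    have := (Finset.sum_eq_zero_iff_of_nonneg fun a _ =>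
      mul_nonneg measureReal_nonneg (hQ a 0)).1 h i.succ (Finset.mem_univ _)
    exact (mul_eq_zero.1 this).resolve_right hi'.ne'
  have hv0 : ∀ j, v j = 0 := by
    intro j
    obtain ⟨n, -, hn⟩ := (isIrreducible_iff_exists_pow_pos hP.nonneg).1 hP j i
    have h1 : ∑ j, v j * (blockP Q ^ n) j i = 0 := by
      have := congrFun (pow_vecMul_of_eigenvector hv1 n) i
      rwa [one_pow, one_smul, hvi] at this
    have := (Finset.sum_eq_zero_iff_of_nonneg fun a _ => mul_nonneg measureReal_nonneg
      (pow_nonneg_apply hP.nonneg n a i)).1 h1 j (Finset.mem_univ _)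
    exact (mul_eq_zero.1 this).resolve_right hn.ne'
  have h1 := hX.sum_measureReal_eq_one
  rw [Fin.sum_univ_succ, ← h0, zero_add, Finset.sum_eq_zero fun j _ => hv0 j] at h1
  exact zero_ne_one h1

theorem IsStationaryMarkovChain.renewalProb_succ (hX : IsStationaryMarkovChain μ Q X)
    (hQ : ∀ a b, 0 ≤ Q a b) (h0 : 0 < μ.real {ω | X 0 ω = 0}) (k : ℕ) :
    renewalProb μ (image X) (k + 1) =
      (rowV Q ᵥ* blockP Q ^ k ⬝ᵥ colW Q) / (rowV Q ᵥ* blockP Q ^ k ⬝ᵥ 1) := by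
  have e1 : renewalProb μ (image X) (k + 1) = μ.real {ω | historyOf X (-1) ω ∈
      excursionSet Set.univ 0 (k + 1) ∧ X (-1 + 1) ω = 0} /
      μ.real {ω | historyOf X (-1) ω ∈ excursionSet Set.univ 0 (k + 1)} := by
    simp only [renewalProb, image_zero_eq_one_iff, lastOneAt_pastOf_iff, and_comm]
  rw [e1, hX.excursion_step hQ MeasurableSet.univ, hX.excursion_sum hQ MeasurableSet.univ]
  simp only [Set.mem_univ, true_and]
  rw [hX.measureReal_eq, mul_div_mul_left _ _ h0.ne', mul_apply, Fin.sum_univ_succ,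
    Fin.sum_univ_succ, taboo_pow_zero_zero, zero_mul, zero_add, zero_add]
  simp only [taboo_pow_zero_succ, dotProduct, Pi.one_apply, mul_one, colW]

theorem rowV_dotProduct_pos (hQ : ∀ a b, 0 ≤ Q a b) (hV : rowV Q ≠ 0) {φ : Fin N → ℝ}
    (hφ : ∀ i, 0 < φ i) : 0 < rowV Q ⬝ᵥ φ := by
  obtain ⟨j, hj⟩ := Function.ne_iff.1 hV
  exact Finset.sum_pos' (fun i _ => mul_nonneg (hQ _ _) (hφ i).le)
    ⟨j, Finset.mem_univ _, mul_pos (lt_of_le_of_ne (hQ _ _) (Ne.symm hj)) (hφ j)⟩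

/-- Pairing the balance equation with `φ` makes `lam * (v ⬝ᵥ φ)` smaller than `v ⬝ᵥ φ` by the
strictly positive inflow from the distinguished state. -/
theorem IsStationaryMarkovChain.eigenvalue_lt_one (hX : IsStationaryMarkovChain μ Q X)
    (hQ : ∀ a b, 0 ≤ Q a b) (hV : rowV Q ≠ 0) (h0 : 0 < μ.real {ω | X 0 ω = 0}) {lam : ℝ}
    {φ : Fin N → ℝ} (hφpos : ∀ i, 0 < φ i) (hφ : blockP Q *ᵥ φ = lam • φ) : lam < 1 := by
  set v : Fin N → ℝ := fun i => μ.real {ω | X 0 ω = i.succ} with hv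
  have h1 : lam * (v ⬝ᵥ φ) = v ⬝ᵥ φ - μ.real {ω | X 0 ω = 0} * (rowV Q ⬝ᵥ φ) := by
    rw [← smul_eq_mul, ← dotProduct_smul, ← hφ, dotProduct_mulVec, hX.vecMul_blockP hQ,
      sub_dotProduct, smul_dotProduct, smul_eq_mul]
  have h2 := mul_pos h0 (rowV_dotProduct_pos hQ hV hφpos)
  have h3 : 0 ≤ v ⬝ᵥ φ :=
    Finset.sum_nonneg fun i _ => mul_nonneg measureReal_nonneg (hφpos i).le
  by_contra h
  nlinarith [mul_nonneg (sub_nonneg.2 (not_lt.1 h)) h3]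

/-- Almost surely, the distinguished symbol has been visited in the past. -/
theorem IsStationaryMarkovChain.ae_exists_lastOneAt (hX : IsStationaryMarkovChain μ Q X)
    (hQ : ∀ a b, 0 ≤ Q a b) (hV : rowV Q ≠ 0) (h0 : 0 < μ.real {ω | X 0 ω = 0}) {lam : ℝ}
    (hlam : 0 < lam) {φ : Fin N → ℝ} (hφpos : ∀ i, 0 < φ i) (hφ : blockP Q *ᵥ φ = lam • φ) :
    ∀ᵐ ω ∂μ, ∃ k, LastOneAt (pastOf (image X) ω) k := by
  have hlam1 := hX.eigenvalue_lt_one hQ hV h0 hφpos hφ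
  obtain ⟨j0, -⟩ := Function.ne_iff.1 hV
  have : Nonempty (Fin N) := ⟨j0⟩
  obtain ⟨ε, hε, hle⟩ := exists_pos_forall_le hφpos
  set v : Fin N → ℝ := fun i => μ.real {ω | X 0 ω = i.succ} with hv
  set E : Set Ω := {ω | ∀ i : ℕ, X (-1 - (i : ℕ)) ω ≠ 0} with hE
  have hPnn : ∀ i j, 0 ≤ blockP Q i j := fun i j => hQ _ _
  -- Starting from the state `n` steps back, the survival probability is at most `P ^ n 1 ≤ P ^ n φ
  -- / ε = lam ^ n φ / ε`.
  have hbound : ∀ n : ℕ, μ.real E ≤ lam ^ n * ((v ⬝ᵥ φ) / ε) := by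
    intro n
    have hsub : E ⊆ ⋃ i : Fin N, {ω | historyOf X (-1) ω ∈ excursionSet Set.univ i.succ n} := by
      intro ω hω
      obtain ⟨i, hi⟩ := Fin.exists_succ_eq.2 (hω n)
      refine Set.mem_iUnion.2 ⟨i, ?_⟩
      exact ⟨Set.mem_univ _, hi.symm, fun l _ => hω l⟩
    calc μ.real E ≤ μ.real (⋃ i : Fin N,
          {ω | historyOf X (-1) ω ∈ excursionSet Set.univ i.succ n}) := measureReal_mono hsub
      _ ≤ ∑ i : Fin N, μ.real {ω | historyOf X (-1) ω ∈ excursionSet Set.univ i.succ n} :=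
          measureReal_iUnion_fintype_le _
      _ ≤ ∑ i : Fin N, v i * (lam ^ n * φ i / ε) := by
          refine Finset.sum_le_sum fun i _ => ?_
          rw [hX.excursion_sum hQ MeasurableSet.univ]
          simp only [Set.mem_univ, true_and]
          rw [hX.measureReal_eq, Fin.sum_univ_succ, taboo_pow_succ_zero, zero_add]
          refine mul_le_mul_of_nonneg_left ?_ measureReal_nonneg
          rw [le_div_iff₀ hε, Finset.sum_mul]
          have h1 := congrFun (pow_mulVec_of_eigenvector hφ n) i
          rw [Pi.smul_apply, smul_eq_mul] at h1
          rw [← h1]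
          refine Finset.sum_le_sum fun j _ => ?_
          rw [taboo_pow_succ_succ]
          exact mul_le_mul_of_nonneg_left (hle j) (pow_nonneg_apply hPnn n i j)
      _ = lam ^ n * ((v ⬝ᵥ φ) / ε) := by
          rw [dotProduct, Finset.sum_div, Finset.mul_sum]
          exact Finset.sum_congr rfl fun i _ => by ring
  have hE0 : μ.real E = 0 := by
    have hlim := (tendsto_pow_atTop_nhds_zero_of_lt_one hlam.le hlam1).mul_const ((v ⬝ᵥ φ) / ε)
    rw [zero_mul] at hlim
    exact le_antisymm (ge_of_tendsto' hlim hbound) measureReal_nonneg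
  rw [measureReal_eq_zero_iff] at hE0
  filter_upwards [measure_eq_zero_iff_ae_notMem.1 hE0] with ω hω
  classical
  simp only [hE, Set.mem_ofPred_eq, not_forall, not_not] at hω
  refine ⟨Nat.find hω, ?_⟩
  rw [lastOneAt_pastOf_iff]
  exact ⟨Set.mem_univ _, Nat.find_spec hω, fun i hi => Nat.find_min hω hi⟩

/-- The event `L` belongs to the past, and `renewal` says that on `L` the constant has the correct
integral over every event of the past. -/
theorem IsStationaryMarkovChain.condExp_eq_renewalProb (hX : IsStationaryMarkovChain μ Q X)
    (hQ : ∀ a b, 0 ≤ Q a b) :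
    ∀ᵐ ω ∂μ, ∀ k, LastOneAt (pastOf (image X) ω) k →
      (μ[(image X 0 ⁻¹' {1}).indicator (fun _ => (1 : ℝ)) |
        MeasurableSpace.comap (pastOf (image X)) inferInstance]) ω =
          renewalProb μ (image X) k := by
  rw [ae_all_iff]
  intro k
  have hmle : MeasurableSpace.comap (pastOf (image X)) inferInstance ≤ ‹MeasurableSpace Ω› := hX.measurable_pastOf_image.comap_le
  set f : Ω → ℝ := (image X 0 ⁻¹' {1}).indicator (fun _ => (1 : ℝ)) with hf
  set L : Set Ω := {ω | LastOneAt (pastOf (image X) ω) k} with hL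
  have hLm : MeasurableSet[MeasurableSpace.comap (pastOf (image X)) inferInstance] L := ⟨_, measurableSet_lastOneAt k, rfl⟩
  have hf1 := hX.measurableSet_image_eq 1
  have hfint : Integrable f μ := (integrable_const 1).indicator hf1
  have h1 : L.indicator (fun _ => renewalProb μ (image X) k) =ᵐ[μ]
      μ[L.indicator f | MeasurableSpace.comap (pastOf (image X)) inferInstance] := by
    refine ae_eq_condExp_of_forall_setIntegral_eq hmle (hfint.indicator (hmle _ hLm))
      (fun s _ _ => ((integrable_const _).indicator (hmle _ hLm)).integrableOn) ?_
      ((stronglyMeasurable_const.indicator hLm).aestronglyMeasurable)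
    rintro _ ⟨B, hB, rfl⟩ -
    have hr := hX.renewal hQ hB k
    rw [setIntegral_indicator (hmle _ hLm), setIntegral_indicator (hmle _ hLm), hf,
      setIntegral_indicator hf1, setIntegral_const, setIntegral_const, smul_eq_mul, smul_eq_mul,
      mul_one, mul_comm]
    exact hr.symm
  have h2 := condExp_indicator hfint hLm
  filter_upwards [h1, h2] with ω hω1 hω2 hω
  rw [hω2, Set.indicator_of_mem (show ω ∈ L from hω), Set.indicator_of_mem (show ω ∈ L from hω)]
    at hω1
  exact hω1.symm

end Stationary

/-! ### Kernels depending on the last `1`: continuity and compatibility -/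

section RenewalKernel

theorem LastOneAt.eq {a : Past (Fin 2)} {k l : ℕ} (hk : LastOneAt a k) (hl : LastOneAt a l) :
    k = l := by
  rcases lt_trichotomy k l with h | h | h
  · exact absurd (hl.2 k h) (by rw [hk.1]; decide)
  · exact h
  · exact absurd (hk.2 l h) (by rw [hl.1]; decide)

theorem LastOneAt.congr {a b : Past (Fin 2)} {k : ℕ} (ha : LastOneAt a k)
    (h : ∀ i ≤ k, b i = a i) : LastOneAt b k :=
  ⟨by rw [h k le_rfl, ha.1], fun i hi => by rw [h i hi.le, ha.2 i hi]⟩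

open Classical in
/-- The function of the past that depends only on the position of the last `1`. -/
noncomputable def renewalFun (p : ℕ → ℝ) (l : ℝ) (a : Past (Fin 2)) : ℝ :=
  if h : ∃ k, LastOneAt a k then p h.choose else l

variable {p : ℕ → ℝ} {l : ℝ}

theorem renewalFun_of_lastOneAt {a : Past (Fin 2)} {k : ℕ} (h : LastOneAt a k) :
    renewalFun p l a = p k := by
  have hex : ∃ k, LastOneAt a k := ⟨k, h⟩
  rw [renewalFun, dif_pos hex, hex.choose_spec.eq h]

theorem renewalFun_cases (p : ℕ → ℝ) (l : ℝ) (a : Past (Fin 2)) (n : ℕ) :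
    (∃ k < n, LastOneAt a k) ∨ (∃ k ≥ n, renewalFun p l a = p k) ∨ renewalFun p l a = l := by
  by_cases h : ∃ k, LastOneAt a k
  · obtain ⟨k, hk⟩ := h
    rcases lt_or_ge k n with hkn | hkn
    · exact Or.inl ⟨k, hkn, hk⟩
    · exact Or.inr (Or.inl ⟨k, hkn, renewalFun_of_lastOneAt hk⟩)
  · exact Or.inr (Or.inr (by rw [renewalFun, dif_neg h]))

theorem eventually_eq_prefix (a : Past (Fin 2)) (n : ℕ) : ∀ᶠ b in 𝓝 a, ∀ i ≤ n, b i = a i :=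
  (eventually_all_finite (Set.finite_Iic n)).2 fun i _ =>
    (continuous_apply i).continuousAt.eventually_mem ((isOpen_discrete {a i}).mem_nhds rfl)

/-- Locally constant at pasts containing a `1`; near the all-zero past the values are `l` or `p k`
with `k` large. -/
theorem continuous_renewalFun (hlim : Tendsto p atTop (𝓝 l)) : Continuous (renewalFun p l) := by
  rw [continuous_iff_continuousAt]
  intro a
  by_cases h : ∃ k, LastOneAt a k
  · obtain ⟨k, hk⟩ := h
    refine (continuousAt_const (y := p k)).congr ?_
    filter_upwards [eventually_eq_prefix a k] with b hb
    exact (renewalFun_of_lastOneAt (hk.congr hb)).symm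
  · have ha : renewalFun p l a = l := by rw [renewalFun, dif_neg h]
    rw [Metric.continuousAt_iff', ha]
    intro ε hε
    obtain ⟨K, hK⟩ := Metric.tendsto_atTop.1 hlim ε hε
    filter_upwards [eventually_eq_prefix a K] with b hb
    rcases renewalFun_cases p l b K with ⟨k, hk, hbk⟩ | ⟨k, hk, hbk⟩ | hbk
    · exact absurd ⟨k, hbk.congr fun i hi => (hb i (hi.trans hk.le)).symm⟩ h
    · rw [hbk]; exact hK k hk
    · rw [hbk, dist_self]; exact hε

/-- The Bernoulli kernel with success probability `f`. -/
noncomputable def bernoulliKernel {α : Type*} [MeasurableSpace α] (f : α → ℝ)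
    (hf : Measurable f) : Kernel α (Fin 2) where
  toFun a := ENNReal.ofReal (f a) • Measure.dirac 1 + ENNReal.ofReal (1 - f a) • Measure.dirac 0
  measurable' := by
    refine Measure.measurable_of_measurable_coe _ fun s hs => ?_
    simp only [Measure.add_apply, Measure.smul_apply, smul_eq_mul]
    exact ((ENNReal.measurable_ofReal.comp hf).mul_const _).add
      ((ENNReal.measurable_ofReal.comp (hf.const_sub 1)).mul_const _)

theorem bernoulliKernel_apply {α : Type*} [MeasurableSpace α] (f : α → ℝ)
    (hf : Measurable f) (a : α) : bernoulliKernel f hf a =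
      ENNReal.ofReal (f a) • Measure.dirac 1 + ENNReal.ofReal (1 - f a) • Measure.dirac 0 := rfl

theorem isMarkovKernel_bernoulliKernel {α : Type*} [MeasurableSpace α] {f : α → ℝ}
    {hf : Measurable f} (h0 : ∀ a, 0 ≤ f a) (h1 : ∀ a, f a ≤ 1) :
    IsMarkovKernel (bernoulliKernel f hf) := by
  refine ⟨fun a => ⟨?_⟩⟩
  rw [bernoulliKernel_apply, Measure.add_apply, Measure.smul_apply, Measure.smul_apply,
    measure_univ, measure_univ, smul_eq_mul, smul_eq_mul, mul_one, mul_one,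
    ← ENNReal.ofReal_add (h0 a) (sub_nonneg.2 (h1 a))]
  simp

theorem bernoulliKernel_real_one {α : Type*} [MeasurableSpace α] {f : α → ℝ}
    {hf : Measurable f} (h0 : ∀ a, 0 ≤ f a) (a : α) :
    (bernoulliKernel f hf a).real {1} = f a := by
  rw [bernoulliKernel_apply, Measure.real, Measure.add_apply, Measure.smul_apply,
    Measure.smul_apply]
  simp [h0 a]

theorem real_singleton_zero {α : Type*} [MeasurableSpace α] (κ : Kernel α (Fin 2))
    [IsMarkovKernel κ] (a : α) : (κ a).real {0} = 1 - (κ a).real {1} := by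
  rw [← probReal_compl_eq_one_sub (measurableSet_singleton 1)]
  congr 1
  ext x
  fin_cases x <;> simp

theorem abs_real_sub_real {α : Type*} [MeasurableSpace α] (κ : Kernel α (Fin 2))
    [IsMarkovKernel κ] (a b : α) (x : Fin 2) :
    |(κ a).real {x} - (κ b).real {x}| = |(κ a).real {1} - (κ b).real {1}| := by
  fin_cases x
  · simp only [Fin.zero_eta, real_singleton_zero]
    rw [sub_sub_sub_cancel_left, abs_sub_comm]
  · rfl

theorem continuityRate_nonneg {S : Type*} [MeasurableSpace S] (κ : Kernel (Past S) S) (n : ℕ) :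
    0 ≤ continuityRate κ n := Real.iSup_nonneg fun _ => abs_nonneg _

theorem append_apply_of_lt {S : Type*} {n : ℕ} (a : Fin n → S) (y z : Past S) {i : ℕ}
    (hi : i < n) : Past.append a y i = Past.append a z i := by
  simp [Past.append, hi]

/-- If the common `n` symbols contain a `1`, the two values coincide; otherwise each lies within `E`
of `l`. -/
theorem continuityRate_le {κ : Kernel (Past (Fin 2)) (Fin 2)} [IsMarkovKernel κ]
    (hκ : ∀ a, (κ a).real {1} = renewalFun p l a) {n : ℕ} {E : ℝ} (hE0 : 0 ≤ E)
    (hE : ∀ k ≥ n, |p k - l| ≤ E) : continuityRate κ n ≤ 2 * E := by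
  refine Real.iSup_le (fun q => ?_) (by positivity)
  obtain ⟨x, a, y, z⟩ := q
  simp only
  rw [abs_real_sub_real, hκ, hκ]
  have hcase : ∀ y z : Past (Fin 2), (∃ k < n, LastOneAt (Past.append a y) k) →
      renewalFun p l (Past.append a y) = renewalFun p l (Past.append a z) := by
    rintro y z ⟨k, hk, hl⟩
    rw [renewalFun_of_lastOneAt hl, renewalFun_of_lastOneAt
      (hl.congr fun i hi => append_apply_of_lt a z y (hi.trans_lt hk))]
  have hbd : ∀ w : Past (Fin 2), ((∃ k ≥ n, renewalFun p l w = p k) ∨ renewalFun p l w = l) →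
      |renewalFun p l w - l| ≤ E := by
    rintro w (⟨k, hk, h⟩ | h)
    · rw [h]; exact hE k hk
    · rw [h, sub_self, abs_zero]; exact hE0
  rcases renewalFun_cases p l (Past.append a y) n with hy | hy
  · rw [hcase y z hy, sub_self, abs_zero]; positivity
  rcases renewalFun_cases p l (Past.append a z) n with hz | hz
  · rw [hcase z y hz, sub_self, abs_zero]; positivity
  calc _ ≤ |renewalFun p l (Past.append a y) - l| + |l - renewalFun p l (Past.append a z)| :=
        abs_sub_le _ _ _
    _ ≤ 2 * E := by
        rw [abs_sub_comm l]
        linarith [hbd _ hy, hbd _ hz]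

variable {N : ℕ} {Q : Matrix (Fin (N + 1)) (Fin (N + 1)) ℝ} {Ω : Type*} [MeasurableSpace Ω]
  {μ : Measure Ω} [IsProbabilityMeasure μ] {X : ℤ → Ω → Fin (N + 1)}

theorem renewalProb_mem_Icc (Y : ℤ → Ω → Fin 2) (k : ℕ) :
    renewalProb μ Y k ∈ Set.Icc (0 : ℝ) 1 :=
  ⟨div_nonneg measureReal_nonneg measureReal_nonneg,
    div_le_one_of_le₀ (measureReal_mono fun _ h => h.2) measureReal_nonneg⟩

/-- If the renewal probabilities converge, the image process is compatible with a continuous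
kernel which depends only on the position of the last `1`. -/
theorem IsStationaryMarkovChain.exists_continuousKernel (hX : IsStationaryMarkovChain μ Q X)
    (hQ : ∀ a b, 0 ≤ Q a b)
    (hae : ∀ᵐ ω ∂μ, ∃ k, LastOneAt (pastOf (image X) ω) k)
    (hlim : Tendsto (renewalProb μ (image X)) atTop (𝓝 l)) :
    ∃ κ : Kernel (Past (Fin 2)) (Fin 2), IsMarkovKernel κ ∧ Compatible μ (image X) κ ∧
      (∀ a, (κ a).real {1} = renewalFun (renewalProb μ (image X)) l a) ∧ ContinuousKernel κ := by
  set p := renewalProb μ (image X) with hp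
  have hl : l ∈ Set.Icc (0 : ℝ) 1 :=
    isClosed_Icc.mem_of_tendsto hlim (Eventually.of_forall fun k => renewalProb_mem_Icc _ k)
  have hmem : ∀ a, renewalFun p l a ∈ Set.Icc (0 : ℝ) 1 := by
    intro a
    rcases renewalFun_cases p l a 0 with ⟨k, hk, -⟩ | ⟨k, -, h⟩ | h
    · exact absurd hk (Nat.not_lt_zero k)
    · rw [h]; exact renewalProb_mem_Icc _ k
    · rw [h]; exact hl
  have hcont := continuous_renewalFun hlim
  have hmk : IsMarkovKernel (bernoulliKernel (renewalFun p l) hcont.measurable) :=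
    isMarkovKernel_bernoulliKernel (fun a => (hmem a).1) fun a => (hmem a).2
  have hone : ∀ a, (bernoulliKernel (renewalFun p l) hcont.measurable a).real {1} =
      renewalFun p l a := bernoulliKernel_real_one fun a => (hmem a).1
  have hc1 : μ[(image X 0 ⁻¹' {1}).indicator (fun _ => (1 : ℝ)) |
      MeasurableSpace.comap (pastOf (image X)) inferInstance] =ᵐ[μ]
      fun ω => renewalFun p l (pastOf (image X) ω) := by
    filter_upwards [hX.condExp_eq_renewalProb hQ, hae] with ω h1 ⟨k, hk⟩
    rw [h1 k hk, renewalFun_of_lastOneAt hk]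
  refine ⟨_, hmk, fun x => ?_, hone, fun a x => ?_⟩
  · fin_cases x
    · have hmle : MeasurableSpace.comap (pastOf (image X)) inferInstance ≤ ‹MeasurableSpace Ω› :=
        hX.measurable_pastOf_image.comap_le
      have hind : (image X 0 ⁻¹' {0}).indicator (fun _ => (1 : ℝ)) =
          (fun _ => (1 : ℝ)) - (image X 0 ⁻¹' {1}).indicator (fun _ => (1 : ℝ)) := by
        funext ω
        rcases Fin.exists_fin_two.1 ⟨image X 0 ω, rfl⟩ with h | h <;> simp [h, Set.indicator]
      simp only [Fin.zero_eta, real_singleton_zero, hone]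
      rw [hind]
      refine (condExp_sub (integrable_const 1)
        ((integrable_const 1).indicator (hX.measurableSet_image_eq 1)) _).trans ?_
      rw [condExp_const hmle]
      filter_upwards [hc1] with ω hω
      rw [Pi.sub_apply, hω]
    · simp only [Fin.mk_one, hone]
      exact hc1
  · fin_cases x
    · simp only [Fin.zero_eta, real_singleton_zero, hone]
      exact (continuous_const.sub hcont).continuousAt
    · simp only [Fin.mk_one, hone]
      exact hcont.continuousAt

/-- If the image process is continuous, the renewal probabilities converge. -/
theorem IsStationaryMarkovChain.tendsto_renewalProb_of_continuousProcess
    (hX : IsStationaryMarkovChain μ Q X) (hQ : ∀ a b, 0 ≤ Q a b)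
    (hpos : ∀ k, μ {ω | LastOneAt (pastOf (image X) ω) k} ≠ 0)
    (hc : ContinuousProcess μ (image X)) :
    ∃ l, Tendsto (renewalProb μ (image X)) atTop (𝓝 l) := by
  obtain ⟨κ, -, hcomp, hcont⟩ := hc
  have hae : ∀ᵐ ω ∂μ, ∀ k, LastOneAt (pastOf (image X) ω) k →
      (κ (pastOf (image X) ω)).real {1} = renewalProb μ (image X) k := by
    filter_upwards [hX.condExp_eq_renewalProb hQ, hcomp 1] with ω h1 h2 k hk
    rw [← h1 k hk, h2]
  -- A compatible kernel is determined only almost surely, but each event has positive probability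
  -- and so contains a realised past with the right value. These pasts tend to the all-zero one.
  have hex : ∀ k, ∃ a, LastOneAt a k ∧ (κ a).real {1} = renewalProb μ (image X) k := by
    intro k
    obtain ⟨ω, hω1, hω2⟩ := ((frequently_ae_mem_iff.2 (hpos k)).and_eventually hae).exists
    exact ⟨_, hω1, hω2 k hω1⟩
  choose a ha1 ha2 using hex
  have hlim : Tendsto a atTop (𝓝 0) := by
    refine tendsto_pi_nhds.2 fun i => tendsto_const_nhds.congr' ?_
    filter_upwards [eventually_gt_atTop i] with k hk
    exact ((ha1 k).2 i hk).symm
  exact ⟨_, ((hcont 0 1).tendsto.comp hlim).congr ha2⟩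

end RenewalKernel

/-! ### Rates of convergence for quotients -/

section Rates

open Asymptotics

/-- The sequence need not be decreasing. Writing `k = n + j` with `n, j ≥ 1`, the bound `n + j ≤ 2 *
n * j` splits off a bounded factor in `j`. -/
theorem exists_bound_pow_mul_pow {r : ℝ} (hr0 : 0 ≤ r) (hr1 : r < 1) (D : ℕ) :
    ∃ C : ℝ, 0 ≤ C ∧ ∀ n : ℕ, 1 ≤ n → ∀ k : ℕ, n ≤ k → (k : ℝ) ^ D * r ^ k ≤ C * ((n : ℝ) ^ D * r ^ n) := by
  have h0 : Tendsto (fun n : ℕ => (n : ℝ) ^ D * r ^ n) atTop (𝓝 0) :=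
    tendsto_pow_const_mul_const_pow_of_abs_lt_one D (by rwa [abs_of_nonneg hr0])
  obtain ⟨M, hM⟩ := h0.bddAbove_range
  have hM' : ∀ n : ℕ, (n : ℝ) ^ D * r ^ n ≤ M := fun n => hM ⟨n, rfl⟩
  have hM0 : 0 ≤ M := le_trans (by positivity) (hM' 0)
  refine ⟨1 + 2 ^ D * M, by positivity, fun n hn k hk => ?_⟩
  obtain ⟨j, rfl⟩ := Nat.exists_eq_add_of_le hk
  rcases Nat.eq_zero_or_pos j with rfl | hj
  · rw [add_zero]
    refine le_mul_of_one_le_left (by positivity) ?_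
    linarith [(by positivity : 0 ≤ 2 ^ D * M)]
  · have h1 : ((n + j : ℕ) : ℝ) ≤ 2 * (n * j) := by
      have : n + j ≤ 2 * (n * j) := by nlinarith
      exact_mod_cast this
    have h2 : ((n + j : ℕ) : ℝ) ^ D ≤ (2 * (n * j)) ^ D := by gcongr
    calc ((n + j : ℕ) : ℝ) ^ D * r ^ (n + j) ≤ (2 * (n * j)) ^ D * r ^ (n + j) := by gcongr
      _ = 2 ^ D * ((j : ℝ) ^ D * r ^ j) * ((n : ℝ) ^ D * r ^ n) := by
          rw [mul_pow, mul_pow, pow_add]; ring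
      _ ≤ 2 ^ D * M * ((n : ℝ) ^ D * r ^ n) := by gcongr; exact hM' j
      _ ≤ (1 + 2 ^ D * M) * ((n : ℝ) ^ D * r ^ n) := by gcongr; linarith

theorem isBigO_of_isBigO_succ {u : ℕ → ℝ} {r : ℝ} (hr0 : 0 ≤ r) {D : ℕ}
    (h : (fun n => u (n + 1)) =O[atTop] (fun n : ℕ => (n : ℝ) ^ D * r ^ n)) :
    u =O[atTop] (fun n : ℕ => (n : ℝ) ^ D * r ^ n) := by
  have h1 : (fun n => u (n + 1)) =O[atTop]
      (fun n : ℕ => ((n + 1 : ℕ) : ℝ) ^ D * r ^ (n + 1)) := by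
    refine h.trans (IsBigO.of_bound r⁻¹ ?_)
    filter_upwards [eventually_ge_atTop 1] with n hn
    rw [Real.norm_of_nonneg (by positivity), Real.norm_of_nonneg (by positivity)]
    rcases hr0.lt_or_eq with hr | rfl
    · calc (n : ℝ) ^ D * r ^ n ≤ ((n + 1 : ℕ) : ℝ) ^ D * r ^ n := by gcongr; omega
        _ = r⁻¹ * (((n + 1 : ℕ) : ℝ) ^ D * r ^ (n + 1)) := by rw [pow_succ]; field_simp
    · simp [zero_pow (by omega : n ≠ 0)]
  obtain ⟨C, hC⟩ := h1.bound
  refine IsBigO.of_bound C ?_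
  obtain ⟨n0, hn0⟩ := eventually_atTop.1 hC
  filter_upwards [eventually_ge_atTop (n0 + 1)] with n hn
  have := hn0 (n - 1) (by omega)
  rwa [Nat.sub_add_cancel (by omega)] at this

variable {N : ℕ} {A G : Matrix (Fin N) (Fin N) ℝ} {lam : ℝ}

theorem tendsto_vecMul_dotProduct
    (hlim : Tendsto (fun n : ℕ => (lam ^ n)⁻¹ • A ^ n) atTop (𝓝 G)) (v w : Fin N → ℝ) :
    Tendsto (fun n : ℕ => (v ᵥ* A ^ n ⬝ᵥ w) / lam ^ n) atTop (𝓝 (v ᵥ* G ⬝ᵥ w)) := by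
  have h1 : Tendsto (fun n : ℕ => v ᵥ* ((lam ^ n)⁻¹ • A ^ n) ⬝ᵥ w) atTop (𝓝 (v ᵥ* G ⬝ᵥ w)) :=
    (((continuous_const.matrix_vecMul continuous_id).dotProduct
      continuous_const).tendsto G).comp hlim
  refine h1.congr fun n => ?_
  rw [vecMul_smul, smul_dotProduct, smul_eq_mul, inv_mul_eq_div]

theorem isBigO_vecMul_dotProduct (hlam : 0 < lam)
    (hlim : Tendsto (fun n : ℕ => (lam ^ n)⁻¹ • A ^ n) atTop (𝓝 G)) {z : ℂ} {d : ℕ}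
    (hz : IsSecondEigenvalue A lam z d) (v w : Fin N → ℝ) :
    (fun n : ℕ => (v ᵥ* A ^ n ⬝ᵥ w) - lam ^ n * (v ᵥ* G ⬝ᵥ w)) =O[atTop]
      (fun n : ℕ => (n : ℝ) ^ (d - 1) * ‖z‖ ^ n) := by
  have h1 : (fun n : ℕ => ∑ j, ∑ i, v i * ((A ^ n) i j - lam ^ n * G i j) * w j) =O[atTop]
      (fun n : ℕ => (n : ℝ) ^ (d - 1) * ‖z‖ ^ n) := by
    refine IsBigO.fun_sum fun j _ => IsBigO.fun_sum fun i _ => ?_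
    refine ((isBigO_pow_sub hlam hlim hz i j).const_mul_left (v i * w j)).congr_left fun n => ?_
    ring
  refine h1.congr_left fun n => ?_
  simp only [vecMul, dotProduct, Finset.mul_sum, Finset.sum_mul, ← Finset.sum_sub_distrib]
  exact Finset.sum_congr rfl fun j _ => Finset.sum_congr rfl fun i _ => by ring

/-- Over a common denominator the terms in `lam ^ n * α * β` cancel, leaving only the errors of
numerator and denominator; the denominator eventually exceeds `lam ^ n * β / 2`. -/
theorem isBigO_ratio_sub (hlam : 0 < lam)
    (hlim : Tendsto (fun n : ℕ => (lam ^ n)⁻¹ • A ^ n) atTop (𝓝 G)) {z : ℂ} {d : ℕ}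
    (hz : IsSecondEigenvalue A lam z d) (v w u : Fin N → ℝ) (hu : 0 < v ᵥ* G ⬝ᵥ u) :
    (fun n : ℕ => (v ᵥ* A ^ n ⬝ᵥ w) / (v ᵥ* A ^ n ⬝ᵥ u) - (v ᵥ* G ⬝ᵥ w) / (v ᵥ* G ⬝ᵥ u))
      =O[atTop] (fun n : ℕ => (n : ℝ) ^ (d - 1) * (‖z‖ / lam) ^ n) := by
  set α := v ᵥ* G ⬝ᵥ w
  set β := v ᵥ* G ⬝ᵥ u
  have hnum : (fun n : ℕ => ((v ᵥ* A ^ n ⬝ᵥ w) - lam ^ n * α) * β -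
      α * ((v ᵥ* A ^ n ⬝ᵥ u) - lam ^ n * β)) =O[atTop]
      (fun n : ℕ => (n : ℝ) ^ (d - 1) * ‖z‖ ^ n) :=
    (((isBigO_vecMul_dotProduct hlam hlim hz v w).const_mul_left β).congr_left
      fun n => mul_comm _ _).sub ((isBigO_vecMul_dotProduct hlam hlim hz v u).const_mul_left α)
  have hev : ∀ᶠ n : ℕ in atTop, β / 2 < (v ᵥ* A ^ n ⬝ᵥ u) / lam ^ n :=
    (tendsto_vecMul_dotProduct hlim v u).eventually_const_lt (by linarith)
  have hden : (fun n : ℕ => ((v ᵥ* A ^ n ⬝ᵥ u) * β)⁻¹) =O[atTop] (fun n : ℕ => (lam ^ n)⁻¹) := by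
    refine IsBigO.of_bound (β / 2 * β)⁻¹ ?_
    filter_upwards [hev] with n hn
    have hp : 0 < lam ^ n := by positivity
    rw [lt_div_iff₀ hp] at hn
    have hb : 0 < (v ᵥ* A ^ n ⬝ᵥ u) := lt_trans (by positivity) hn
    rw [Real.norm_of_nonneg (by positivity), Real.norm_of_nonneg (by positivity), ← mul_inv]
    refine inv_anti₀ (by positivity) ?_
    calc β / 2 * β * lam ^ n = (β / 2 * lam ^ n) * β := by ring
      _ ≤ _ := by gcongr
  refine (hnum.mul hden).congr' ?_ (Eventually.of_forall fun n => ?_)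
  · filter_upwards [hev] with n hn
    have hp : 0 < lam ^ n := by positivity
    rw [lt_div_iff₀ hp] at hn
    have hb : 0 < (v ᵥ* A ^ n ⬝ᵥ u) := lt_trans (by positivity) hn
    field_simp
    ring
  · simp only [div_pow]
    ring

theorem dotProduct_one_pos {v φ : Fin N → ℝ} (hv : ∀ i, 0 ≤ v i) (h : 0 < v ⬝ᵥ φ) :
    0 < v ⬝ᵥ 1 := by
  obtain ⟨j, -, hj⟩ := Finset.exists_ne_zero_of_sum_ne_zero h.ne'
  simp only [dotProduct, Pi.one_apply, mul_one]
  exact Finset.sum_pos' (fun i _ => hv i) ⟨j, Finset.mem_univ _,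
    lt_of_le_of_ne (hv j) (Ne.symm (left_ne_zero_of_mul hj))⟩

theorem vecMul_apply_nonneg {M : Matrix (Fin N) (Fin N) ℝ} (hM : ∀ i j, 0 ≤ M i j)
    {v : Fin N → ℝ} (hv : ∀ i, 0 ≤ v i) (j : Fin N) : 0 ≤ (v ᵥ* M) j := by
  rw [vecMul, dotProduct]
  exact Finset.sum_nonneg fun i _ => mul_nonneg (hv i) (hM i j)

/-- A sequence converges as soon as it converges to the same limit along each residue class. -/
theorem tendsto_of_residues {u : ℕ → ℝ} {h : ℕ} (hh : 0 < h) {l : ℝ}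
    (H : ∀ r < h, Tendsto (fun q => u (h * q + r)) atTop (𝓝 l)) : Tendsto u atTop (𝓝 l) := by
  rw [Metric.tendsto_atTop]
  intro ε hε
  have h1 : ∀ᶠ q in atTop, ∀ r ∈ Finset.range h, dist (u (h * q + r)) l < ε :=
    (Finset.eventually_all _).2 fun r hr => Metric.tendsto_nhds.1 (H r (Finset.mem_range.1 hr)) ε hε
  obtain ⟨q0, hq0⟩ := eventually_atTop.1 h1
  refine ⟨h * q0, fun n hn => ?_⟩
  have := hq0 (n / h) ((Nat.le_div_iff_mul_le hh).2 (by rwa [mul_comm])) (n % h)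
    (Finset.mem_range.2 (Nat.mod_lt n hh))
  rwa [Nat.div_add_mod] at this

end Rates

/-! ### Assembly of the primitive and periodic cases -/

section Main

open Asymptotics

variable {N : ℕ} {Q : Matrix (Fin (N + 1)) (Fin (N + 1)) ℝ} {Ω : Type*} [MeasurableSpace Ω]
  {μ : Measure Ω} [IsProbabilityMeasure μ] {X : ℤ → Ω → Fin (N + 1)}

theorem continuityRate_isBigO {κ : Kernel (Past (Fin 2)) (Fin 2)} [IsMarkovKernel κ] {p : ℕ → ℝ}
    {l : ℝ} (hκ : ∀ a, (κ a).real {1} = renewalFun p l a) {r : ℝ} (hr0 : 0 ≤ r) (hr1 : r < 1)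
    {D : ℕ} (hp : (fun n => p n - l) =O[atTop] (fun n : ℕ => (n : ℝ) ^ D * r ^ n)) :
    (fun n : ℕ => continuityRate κ n) =O[atTop] (fun n : ℕ => (n : ℝ) ^ D * r ^ n) := by
  obtain ⟨C, hC0, hC⟩ := exists_bound_pow_mul_pow hr0 hr1 D
  obtain ⟨c, hc0, hc⟩ := hp.exists_nonneg
  obtain ⟨n0, hn0⟩ := eventually_atTop.1 hc.bound
  refine IsBigO.of_bound (2 * (c * C)) ?_
  filter_upwards [eventually_ge_atTop (max n0 1)] with n hn
  have hn1 : n0 ≤ n := le_of_max_le_left hn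
  have hn2 : 1 ≤ n := le_of_max_le_right hn
  rw [Real.norm_of_nonneg (continuityRate_nonneg κ n), Real.norm_of_nonneg (by positivity),
    mul_assoc]
  refine continuityRate_le hκ (by positivity) fun k hk => ?_
  have h1 := hn0 k (hn1.trans hk)
  rw [Real.norm_eq_abs, Real.norm_of_nonneg (by positivity)] at h1
  calc _ ≤ c * ((k : ℝ) ^ D * r ^ k) := h1
    _ ≤ c * (C * ((n : ℝ) ^ D * r ^ n)) := mul_le_mul_of_nonneg_left (hC n hn2 k hk) hc0
    _ = _ := by ring

/-- Pairing with `φ` in place of `1` gives `lam ^ r * (V ⬝ᵥ φ) > 0`, so the nonnegative row vector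
is nonzero. -/
theorem rowV_vecMul_projector_pos (hQ : ∀ a b, 0 ≤ Q a b) (hV : rowV Q ≠ 0)
    {G : Matrix (Fin N) (Fin N) ℝ} (hG : ∀ i j, 0 ≤ G i j) {lam : ℝ} (hlam : 0 < lam)
    {φ : Fin N → ℝ} (hφpos : ∀ i, 0 < φ i) (hφ : blockP Q *ᵥ φ = lam • φ) (hGφ : G *ᵥ φ = φ)
    (r : ℕ) : 0 < rowV Q ᵥ* G ᵥ* blockP Q ^ r ⬝ᵥ 1 := by
  refine dotProduct_one_pos (φ := φ) ?_ ?_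
  · exact vecMul_apply_nonneg (pow_nonneg_apply (fun i j => hQ _ _) r)
      (vecMul_apply_nonneg hG fun i => hQ _ _)
  · rw [← dotProduct_mulVec, pow_mulVec_of_eigenvector hφ, dotProduct_smul, ← dotProduct_mulVec,
      hGφ, smul_eq_mul]
    exact mul_pos (by positivity) (rowV_dotProduct_pos hQ hV hφpos)

theorem rowV_vecMul_pow_pos (hQ : ∀ a b, 0 ≤ Q a b) (hV : rowV Q ≠ 0) {lam : ℝ} (hlam : 0 < lam)
    {φ : Fin N → ℝ} (hφpos : ∀ i, 0 < φ i) (hφ : blockP Q *ᵥ φ = lam • φ) (k : ℕ) :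
    0 < rowV Q ᵥ* blockP Q ^ k ⬝ᵥ 1 := by
  have := rowV_vecMul_projector_pos hQ hV (G := 1)
    (fun i j => by rw [one_apply]; split_ifs <;> norm_num) hlam hφpos hφ (one_mulVec φ) k
  rwa [vecMul_one] at this

theorem IsStationaryMarkovChain.measure_lastOneAt_ne_zero (hX : IsStationaryMarkovChain μ Q X)
    (hQ : ∀ a b, 0 ≤ Q a b) (hV : rowV Q ≠ 0) (h0 : 0 < μ.real {ω | X 0 ω = 0}) {lam : ℝ}
    (hlam : 0 < lam) {φ : Fin N → ℝ} (hφpos : ∀ i, 0 < φ i) (hφ : blockP Q *ᵥ φ = lam • φ)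
    (k : ℕ) : μ {ω | LastOneAt (pastOf (image X) ω) k} ≠ 0 := by
  rw [← measureReal_ne_zero_iff]
  simp only [lastOneAt_pastOf_iff]
  rw [hX.excursion_sum hQ MeasurableSet.univ]
  simp only [Set.mem_univ, true_and]
  rw [hX.measureReal_eq]
  refine mul_ne_zero h0.ne' ?_
  rcases k with _ | k
  · simp [one_apply]
  · rw [Fin.sum_univ_succ, taboo_pow_zero_zero, zero_add]
    have := rowV_vecMul_pow_pos hQ hV hlam hφpos hφ k
    simp only [dotProduct, Pi.one_apply, mul_one] at this
    simp only [taboo_pow_zero_succ]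
    exact this.ne'

theorem IsStationaryMarkovChain.exists_kernel_of_isPrimitive (hX : IsStationaryMarkovChain μ Q X)
    (hQ : ∀ a b, 0 ≤ Q a b) (hV : rowV Q ≠ 0) (hW : colW Q ≠ 0) (hP : (blockP Q).IsPrimitive) :
    ∃ κ : Kernel (Past (Fin 2)) (Fin 2), IsMarkovKernel κ ∧ Compatible μ (image X) κ ∧
      (∀ (a : Past (Fin 2)) (k : ℕ), LastOneAt a k →
        (κ a).real {1} = renewalProb μ (image X) k) ∧
      ContinuousKernel κ ∧
      ∃ lam₁ : ℝ, 0 < lam₁ ∧ IsPerronValue (blockP Q) lam₁ ∧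
        ∀ (lam₂ : ℂ) (d₂ : ℕ), IsSecondEigenvalue (blockP Q) lam₁ lam₂ d₂ →
          (fun n : ℕ => continuityRate κ n) =O[atTop]
            (fun n : ℕ => (n : ℝ) ^ (d₂ - 1) * (‖lam₂‖ / lam₁) ^ n) := by
  obtain ⟨j0, -⟩ := Function.ne_iff.1 hV
  have : Nonempty (Fin N) := ⟨j0⟩
  have hirr := hP.isIrreducible
  obtain ⟨lam, φ, G, hlam, hφpos, hφ, hlim, hGnn, -⟩ :=
    perron_frobenius hirr (hasPeriod_one_of_isPrimitive hP)
  simp only [pow_one] at hlim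
  have h0 := hX.measureReal_zero_pos hQ hirr hW
  have hGφ := mulVec_eq_self_of_eigenvector hlam.ne' hlim hφ
  have hGpos : 0 < rowV Q ᵥ* G ⬝ᵥ 1 := by
    simpa using rowV_vecMul_projector_pos hQ hV hGnn hlam hφpos hφ hGφ 0
  have hp : Tendsto (renewalProb μ (image X)) atTop
      (𝓝 ((rowV Q ᵥ* G ⬝ᵥ colW Q) / (rowV Q ᵥ* G ⬝ᵥ 1))) := by
    rw [← tendsto_add_atTop_iff_nat 1]
    refine ((tendsto_vecMul_dotProduct hlim (rowV Q) (colW Q)).div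
      (tendsto_vecMul_dotProduct hlim (rowV Q) 1) hGpos.ne').congr fun n => ?_
    rw [hX.renewalProb_succ hQ h0, Pi.div_apply, div_div_div_cancel_right₀ (by positivity)]
  obtain ⟨κ, hκ1, hκ2, hκ3, hκ4⟩ := hX.exists_continuousKernel hQ
    (hX.ae_exists_lastOneAt hQ hV h0 hlam hφpos hφ) hp
  refine ⟨κ, hκ1, hκ2, fun a k hk => by rw [hκ3, renewalFun_of_lastOneAt hk], hκ4, lam, hlam,
    isPerronValue_of_tendsto hlam hlim (fun h => (hφpos j0).ne' (congrFun h j0)) hφ,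
    fun z d hz => ?_⟩
  refine continuityRate_isBigO hκ3 (by positivity)
    ((div_lt_one hlam).2 (norm_second_lt hlam hlim hz)) ?_
  refine isBigO_of_isBigO_succ (by positivity) ?_
  refine (isBigO_ratio_sub hlam hlim hz (rowV Q) (colW Q) 1 hGpos).congr_left fun n => ?_
  rw [hX.renewalProb_succ hQ h0]

theorem IsStationaryMarkovChain.continuousProcess_iff_of_isIrreducible
    (hX : IsStationaryMarkovChain μ Q X)
    (hQ : ∀ a b, 0 ≤ Q a b) (hV : rowV Q ≠ 0) (hW : colW Q ≠ 0) {h : ℕ}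
    (hP : (blockP Q).IsIrreducible) (hh : HasPeriod (blockP Q) h) :
    ∃ (lam : ℝ) (G : Matrix (Fin N) (Fin N) ℝ),
      0 < lam ∧ IsPerronValue (blockP Q ^ h) lam ∧ IsPerronProjector (blockP Q ^ h) lam G ∧
      (∀ i j, 0 ≤ G i j) ∧
      (∀ i j, 0 < G i j ↔ ∃ k : ℕ, 0 < ((blockP Q ^ h) ^ k) i j) ∧
      (∀ r : ℕ, 0 < rowV Q ᵥ* G ᵥ* blockP Q ^ r ⬝ᵥ 1) ∧
      (ContinuousProcess μ (image X) ↔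
        ∀ r : ℕ, 1 ≤ r → r ≤ h - 1 →
          (rowV Q ᵥ* G ᵥ* blockP Q ^ r ⬝ᵥ colW Q) / (rowV Q ᵥ* G ᵥ* blockP Q ^ r ⬝ᵥ 1) =
            (rowV Q ᵥ* G ⬝ᵥ colW Q) / (rowV Q ᵥ* G ⬝ᵥ 1)) := by
  obtain ⟨j0, -⟩ := Function.ne_iff.1 hV
  have : Nonempty (Fin N) := ⟨j0⟩
  obtain ⟨lam, φ, G, hlam, hφpos, hφ, hlim, hGnn, hGacc⟩ := perron_frobenius hP hh
  have hhpos := hh.pos hP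
  have hl : 0 < lam ^ h := by positivity
  have h0 := hX.measureReal_zero_pos hQ hP hW
  have hφh := pow_mulVec_of_eigenvector hφ h
  have hGφ := mulVec_eq_self_of_eigenvector hl.ne' hlim hφh
  have hGpos := rowV_vecMul_projector_pos hQ hV hGnn hlam hφpos hφ hGφ
  refine ⟨lam ^ h, G, hl,
    isPerronValue_of_tendsto hl hlim (fun h => (hφpos j0).ne' (congrFun h j0)) hφh,
    isPerronProjector_of_tendsto hl hlim, hGnn, hGacc, hGpos, ?_⟩
  -- In `P ^ (h * q + r)` the factor `P ^ r` is absorbed into the test vector, and the normalisation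
  -- `lam ^ (h * q)` cancels in the quotient.
  have hres : ∀ r : ℕ, Tendsto (fun q => renewalProb μ (image X) (h * q + r + 1)) atTop
      (𝓝 ((rowV Q ᵥ* G ᵥ* blockP Q ^ r ⬝ᵥ colW Q) / (rowV Q ᵥ* G ᵥ* blockP Q ^ r ⬝ᵥ 1))) := by
    intro r
    have hw : ∀ w : Fin N → ℝ, Tendsto
        (fun q : ℕ => (rowV Q ᵥ* blockP Q ^ (h * q + r) ⬝ᵥ w) / (lam ^ h) ^ q) atTop
        (𝓝 (rowV Q ᵥ* G ᵥ* blockP Q ^ r ⬝ᵥ w)) := by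
      intro w
      have := tendsto_vecMul_dotProduct hlim (rowV Q) (blockP Q ^ r *ᵥ w)
      rw [dotProduct_mulVec] at this
      refine this.congr fun q => ?_
      rw [dotProduct_mulVec, vecMul_vecMul, ← pow_mul, ← pow_add]
    refine ((hw (colW Q)).div (hw 1) (hGpos r).ne').congr fun q => ?_
    rw [hX.renewalProb_succ hQ h0, Pi.div_apply, div_div_div_cancel_right₀ (by positivity)]
  have hzero : rowV Q ᵥ* G ᵥ* blockP Q ^ 0 = rowV Q ᵥ* G := by rw [pow_zero, vecMul_one]
  constructor
  · intro hc r _ _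
    obtain ⟨l, hl⟩ := hX.tendsto_renewalProb_of_continuousProcess hQ
      (hX.measure_lastOneAt_ne_zero hQ hV h0 hlam hφpos hφ) hc
    have hsub : ∀ r : ℕ,
        Tendsto (fun q => renewalProb μ (image X) (h * q + r + 1)) atTop (𝓝 l) := by
      intro r
      refine hl.comp (tendsto_atTop_mono (fun q => ?_) tendsto_id)
      have : q ≤ h * q := Nat.le_mul_of_pos_left q hhpos
      simp only [id]
      omega
    have h1 := tendsto_nhds_unique (hres r) (hsub r)
    have h2 := tendsto_nhds_unique (hres 0) (hsub 0)
    rw [hzero] at h2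
    rw [h1, h2]
  · intro hall
    have hp : Tendsto (renewalProb μ (image X)) atTop
        (𝓝 ((rowV Q ᵥ* G ⬝ᵥ colW Q) / (rowV Q ᵥ* G ⬝ᵥ 1))) := by
      rw [← tendsto_add_atTop_iff_nat 1]
      refine tendsto_of_residues hhpos fun r hr => ?_
      have h1 := hres r
      rcases Nat.eq_zero_or_pos r with rfl | hr0
      · rwa [hzero] at h1
      · rwa [hall r hr0 (by omega)] at h1
    obtain ⟨κ, hκ1, hκ2, -, hκ4⟩ := hX.exists_continuousKernel hQ
      (hX.ae_exists_lastOneAt hQ hV h0 hlam hφpos hφ) hp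
    exact ⟨κ, hκ1, hκ2, hκ4⟩

end Main
end RenewalFactor

theorem theorem1 {N : ℕ} {Ω : Type*} [MeasurableSpace Ω] (μ : Measure Ω) [IsProbabilityMeasure μ]
    (Q : Matrix (Fin (N + 1)) (Fin (N + 1)) ℝ)
    (hQ : Q ∈ Matrix.rowStochastic ℝ (Fin (N + 1)))
    (X : ℤ → Ω → Fin (N + 1)) (hX : IsStationaryMarkovChain μ Q X)
    (hV : rowV Q ≠ 0) (hW : colW Q ≠ 0) :
    ((blockP Q).IsPrimitive →
      ∃ κ : Kernel (Past (Fin 2)) (Fin 2), IsMarkovKernel κ ∧ Compatible μ (image X) κ ∧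
        (∀ (a : Past (Fin 2)) (k : ℕ), LastOneAt a k →
          (κ a).real {1} = renewalProb μ (image X) k) ∧
        ContinuousKernel κ ∧
        ∃ lam₁ : ℝ, 0 < lam₁ ∧ IsPerronValue (blockP Q) lam₁ ∧
          ∀ (lam₂ : ℂ) (d₂ : ℕ), IsSecondEigenvalue (blockP Q) lam₁ lam₂ d₂ →
            (fun n : ℕ => continuityRate κ n) =O[atTop]
              (fun n : ℕ => (n : ℝ) ^ (d₂ - 1) * (‖lam₂‖ / lam₁) ^ n)) ∧
    (∀ h : ℕ, (blockP Q).IsIrreducible → HasPeriod (blockP Q) h →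
      ∃ (lam : ℝ) (G : Matrix (Fin N) (Fin N) ℝ),
        0 < lam ∧ IsPerronValue (blockP Q ^ h) lam ∧ IsPerronProjector (blockP Q ^ h) lam G ∧
        (∀ i j, 0 ≤ G i j) ∧
        (∀ i j, 0 < G i j ↔ ∃ k : ℕ, 0 < ((blockP Q ^ h) ^ k) i j) ∧
        (∀ r : ℕ, 0 < rowV Q ᵥ* G ᵥ* blockP Q ^ r ⬝ᵥ 1) ∧
        (ContinuousProcess μ (image X) ↔
          ∀ r : ℕ, 1 ≤ r → r ≤ h - 1 →
            (rowV Q ᵥ* G ᵥ* blockP Q ^ r ⬝ᵥ colW Q) / (rowV Q ᵥ* G ᵥ* blockP Q ^ r ⬝ᵥ 1) =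
              (rowV Q ᵥ* G ⬝ᵥ colW Q) / (rowV Q ᵥ* G ⬝ᵥ 1))) := by
  have hQ' : ∀ a b, 0 ≤ Q a b := fun a b => nonneg_of_mem_rowStochastic hQ
  exact ⟨hX.exists_kernel_of_isPrimitive hQ' hV hW,
    fun h hP hh => hX.continuousProcess_iff_of_isIrreducible hQ' hV hW hP hh⟩
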